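/- Let $\mathbf C$ be a category with finite limits, equipped with a wide subcategory of maps called \emph{fibrations} that is stable under pullback along arbitrary maps. For maps $k\colon K\to B$ and $p\colon B\to A$, a \emph{pushforward} of $k$ along $p$ is an object $p_*k\in\mathbf C/A$ together with bijections $\mathbf C/A\,(x,p_*k)\cong \mathbf C/B\,(p^*x,k)$ natural in $x\in \mathbf C/A$. Assume that fibrations are stable under pushforward along fibrations: for all fibrations $k\colon K\to B$ and $p\colon B\to A$, a pushforward of $k$ along $p$ exists, and every such pushforward is a fibration. Let $\mathcal I$ be a finite inverse category, i.e. a category with finitely many objects and maps for which there is a degree function $\deg\colon \operatorname{ob}\mathcal I\to\mathbb N$ such that $\deg i>\deg j$ for every non-identity map $i\to j$. For $i\in\mathcal I$ let $\partial(i/\mathcal I)$ be the full subcategory of $i/\mathcal I$ on all objects except $\mathrm{id}_i$. For $X\in\mathbf C^{\mathcal I}$ let $M_iX=\lim\bigl(\partial(i/\mathcal I)\to\mathcal I\xrightarrow{X}\mathbf C\bigr)$ be the matching object, with matching map $m_iX\colon X_i\to M_iX$ induced by the maps $X_f$. A map $p\colon E\to B$ in $\mathbf C^{\mathcal I}$ is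 a \emph{Reedy fibration} if for every $i\in\mathcal I$ the relative matching map $E_i\to B_i\times_{M_iB}M_iE$ is a fibration in $\mathbf C$. Then Reedy fibrations in $\mathbf C^{\mathcal I}$ are stable under pushforward along Reedy fibrations: for all Reedy fibrations $k\colon C\to B$ and $p\colon B\to A$ in $\mathbf C^{\mathcal I}$, a pushforward of $k$ along $p$ exists in $\mathbf C^{\mathcal I}$, and every such pushforward is a Reedy fibration. -/

import Mathlib

open CategoryTheory CategoryTheory.Limits

universe w v u

namespace InverseDiagrams

/-- A category is an *inverse category* if its objects admit a degree function to `ℕ` which is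
strictly decreased by every morphism that is not an identity. -/
class IsInverseCategory (I : Type u) [Category.{v} I] : Prop where
  exists_degree : ∃ deg : I → ℕ, ∀ ⦃i j : I⦄ (f : i ⟶ j),
    (¬ ∃ h : i = j, f = eqToHom h) → deg j < deg i

section Pushforward

variable {C : Type u} [Category.{v} C] [HasPullbacks C]

/-- `q : P ⟶ A` is a pushforward of `k : K ⟶ B` along `p : B ⟶ A`: maps `x ⟶ q` over `A` are in
bijection, naturally in `x`, with maps `p^* x ⟶ k` over `B`. -/
def IsPushforward {A B K P : C} (p : B ⟶ A) (k : K ⟶ B) (q : P ⟶ A) : Prop :=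
  Nonempty (((Over.pullback p).op ⋙ yoneda.obj (Over.mk k)).RepresentableBy (Over.mk q))

/-- A class of maps `W` is *stable under pushforward along itself*: for `k : K ⟶ B` and
`p : B ⟶ A` in `W`, a pushforward of `k` along `p` exists, and every such pushforward is
again in `W`. -/
def StableUnderPushforward (W : MorphismProperty C) : Prop :=
  ∀ ⦃A B K : C⦄ (p : B ⟶ A) (k : K ⟶ B), W p → W k →
    (∃ (P : C) (q : P ⟶ A), IsPushforward p k q) ∧
      ∀ (P : C) (q : P ⟶ A), IsPushforward p k q → W q

end Pushforward

section Matching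

variable {I : Type w} [SmallCategory I]

/-- `∂(i/I)`: the full subcategory of the under category `i/I` on all objects except the
identity map of `i`. -/
abbrev Boundary (i : I) : Type w :=
  ObjectProperty.FullSubcategory (fun f : Under i => f ≠ Under.mk (𝟙 i))

/-- The projection `∂(i/I) ⥤ I`, sending `f : i ⟶ j` to `j`. -/
abbrev Boundary.proj (i : I) : Boundary i ⥤ I :=
  ObjectProperty.ι _ ⋙ Under.forget i

/-- The boundary of an object of a finite category is a finite category. -/
noncomputable instance Boundary.finCategory [FinCategory I] (i : I) :
    FinCategory (Boundary i) where
  fintypeObj := by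
    classical
    have : Finite (Under i) := Finite.of_injective
      (β := Σ j : I, (i ⟶ j)) (fun f => ⟨f.right, f.hom⟩) (by
        rintro ⟨⟨⟨⟩⟩, j, f⟩ ⟨⟨⟨⟩⟩, j', f'⟩ h
        simp only [Sigma.mk.injEq] at h
        obtain ⟨rfl, h⟩ := h
        obtain rfl := eq_of_heq h
        rfl)
    have : Finite (Boundary i) := Finite.of_injective
      (fun f => f.obj) (by rintro ⟨a, _⟩ ⟨b, _⟩ h; cases h; rfl)
    exact Fintype.ofFinite _
  fintypeHom f g := by
    classical
    have : Finite (f ⟶ g) := Finite.of_injective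
      (fun a => (Boundary.proj i).map a) (by
        intro a b h
        exact InducedCategory.hom_ext (Under.UnderMorphism.ext h))
    exact Fintype.ofFinite _

variable {C : Type u} [Category.{v} C] [HasFiniteLimits C] [FinCategory I]

/-- The matching object `M_i X`, the limit of `∂(i/I) ⥤ I ⥤ C`. -/
noncomputable def matchingObj (X : I ⥤ C) (i : I) : C :=
  limit (Boundary.proj i ⋙ X)

/-- The limit projection `M_i X ⟶ X_j` at `f : i ⟶ j` in `∂(i/I)`. -/
noncomputable def matchingObjProj (X : I ⥤ C) (i : I) (f : Boundary i) :
    matchingObj X i ⟶ X.obj f.obj.right :=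
  limit.π (Boundary.proj i ⋙ X) f

/-- The map `M_i p : M_i X ⟶ M_i Y` induced by a map of diagrams `p : X ⟶ Y`. -/
noncomputable def matchingObjMap {X Y : I ⥤ C} (p : X ⟶ Y) (i : I) :
    matchingObj X i ⟶ matchingObj Y i :=
  limMap (Functor.whiskerLeft (Boundary.proj i) p)

/-- The cone of the maps `X_f : X_i ⟶ X_j` for `f : i ⟶ j` in `∂(i/I)`. -/
def matchingCone (X : I ⥤ C) (i : I) : Cone (Boundary.proj i ⋙ X) where
  pt := X.obj i
  π :=
    { app := fun f => X.map f.obj.hom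
      naturality := fun f g a => by simp [← X.map_comp] }

/-- The matching map `m_i X : X_i ⟶ M_i X`, induced by the cone of the maps
`X_f : X_i ⟶ X_j` for `f : i ⟶ j` in `∂(i/I)`. -/
noncomputable def matchingMap (X : I ⥤ C) (i : I) : X.obj i ⟶ matchingObj X i :=
  limit.lift (Boundary.proj i ⋙ X) (matchingCone X i)

@[simp]
theorem matchingMap_proj (X : I ⥤ C) (i : I) (f : Boundary i) :
    matchingMap X i ≫ matchingObjProj X i f = X.map f.obj.hom :=
  limit.lift_π (matchingCone X i) f

@[simp]
theorem matchingObjMap_proj {X Y : I ⥤ C} (p : X ⟶ Y) (i : I) (f : Boundary i) :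
    matchingObjMap p i ≫ matchingObjProj Y i f =
      matchingObjProj X i f ≫ p.app f.obj.right :=
  limMap_π (Functor.whiskerLeft (Boundary.proj i) p) f

/-- The matching map is natural in the diagram. -/
theorem matchingMap_naturality {X Y : I ⥤ C} (p : X ⟶ Y) (i : I) :
    p.app i ≫ matchingMap Y i = matchingMap X i ≫ matchingObjMap p i := by
  refine limit.hom_ext fun f => ?_
  change (p.app i ≫ matchingMap Y i) ≫ matchingObjProj Y i f =
    (matchingMap X i ≫ matchingObjMap p i) ≫ matchingObjProj Y i f
  rw [Category.assoc, Category.assoc, matchingMap_proj, matchingObjMap_proj,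
    ← Category.assoc, matchingMap_proj]
  exact (p.naturality f.obj.hom).symm

/-- The relative matching map `E_i ⟶ B_i ×_{M_i B} M_i E` of a map of diagrams `p : E ⟶ B`. -/
noncomputable def relativeMatchingMap {E B : I ⥤ C} (p : E ⟶ B) (i : I) :
    E.obj i ⟶ pullback (matchingMap B i) (matchingObjMap p i) :=
  pullback.lift (p.app i) (matchingMap E i) (matchingMap_naturality p i)

/-- The Reedy fibrations in `I ⥤ C` with respect to a class `F` of fibrations of `C`: the maps all
of whose relative matching maps are in `F`. -/
def reedyFibrations (F : MorphismProperty C) : MorphismProperty (I ⥤ C) :=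
  fun _ _ p => ∀ i : I, F (relativeMatchingMap p i)

end Matching

end InverseDiagrams

/-! ### Pushforwards via generalized elements -/

namespace InverseDiagrams

/-! By Yoneda, a map from X to stage i of the pushforward should be a point X → A_i together with
maps X ×_{A_j} B_j → K_j over B_j, natural in f : i → j. Such data is a `DiagSection`. Conversely,
if sections at every i are representable, uniqueness makes the representing objects into a diagram,
and that diagram is a pushforward (`isPushforward_of_isUniversal`).

Representability is proved by induction on the degree of i. A section at i amounts to its pushes
along the non-identity maps out of i, a point of A_i over them, and a component at the identity. By
induction the first two are classified by D = A_i ×_{M_i A} lim Q, where Q consists of the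
representing objects on the boundary. The generic boundary data gives γ : D ×_{A_i} B_i → B_i ×_{M_i
B} M_i K, and the component at the identity is a lift through the relative matching map of k. Such
lifts are classified by a pushforward in C along D ×_{A_i} B_i → D, namely that of the pullback of
the relative matching map along γ. Both maps are fibrations, the first because Reedy fibrations are
levelwise fibrations (`app_mem_of_reedyFibrations`). Hence the pushforward P → D exists and is a
fibration (`exists_universal_of_isRelativeMatching`). Up to isomorphism P → D is the relative
matching map of the pushforward, which is therefore a Reedy fibration
(`reedyFibrations_of_isUniversal`).

Maps out of pullbacks are handled through their action on generalized elements, so that no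
comparison of chosen pullbacks is needed. -/

/-- A map `X ×_A B ⟶ K` over `B`, described by its action on generalized elements. -/
structure FiberMap {C : Type u} [Category.{v} C] {A B K X : C} (p : B ⟶ A) (k : K ⟶ B)
    (a : X ⟶ A) where
  app : ∀ {Z : C} (u : Z ⟶ X) (b : Z ⟶ B), u ≫ a = b ≫ p → (Z ⟶ K)
  app_comp : ∀ {Z' Z : C} (g : Z' ⟶ Z) (u : Z ⟶ X) (b : Z ⟶ B) (h : u ≫ a = b ≫ p),
    app (g ≫ u) (g ≫ b) (by simp [h]) = g ≫ app u b h
  app_over : ∀ {Z : C} (u : Z ⟶ X) (b : Z ⟶ B) (h : u ≫ a = b ≫ p), app u b h ≫ k = b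

namespace FiberMap

variable {C : Type u} [Category.{v} C] {A B K X : C} {p : B ⟶ A} {k : K ⟶ B} {a : X ⟶ A}

theorem app_congr (φ : FiberMap p k a) {Z : C} {u u' : Z ⟶ X} {b b' : Z ⟶ B}
    (hu : u = u') (hb : b = b') (h : u ≫ a = b ≫ p) :
    φ.app u b h = φ.app u' b' (by rw [← hu, ← hb, h]) := by
  subst hu hb; rfl

theorem app_eq_comp (φ : FiberMap p k a) {T : C} {s : T ⟶ X} {t : T ⟶ B}
    (w : s ≫ a = t ≫ p) {Z : C} {u : Z ⟶ X} {b : Z ⟶ B} (h : u ≫ a = b ≫ p) (l : Z ⟶ T)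
    (hs : l ≫ s = u) (ht : l ≫ t = b) : φ.app u b h = l ≫ φ.app s t w := by
  subst hs ht
  exact φ.app_comp l s t w

/-- A map out of a pullback of `a` and `p` over `B` acts on generalized elements. -/
noncomputable def ofIsPullback {T : C} {s : T ⟶ X} {t : T ⟶ B} (H : IsPullback s t a p)
    (m : T ⟶ K) (hm : m ≫ k = t) : FiberMap p k a where
  app u b h := H.lift u b h ≫ m
  app_comp g u b h := by
    simp only [← Category.assoc]
    congr 1
    apply H.hom_ext <;> simp
  app_over u b h := by simp [hm]

theorem ofIsPullback_app {T : C} {s : T ⟶ X} {t : T ⟶ B} (H : IsPullback s t a p)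
    (m : T ⟶ K) (hm : m ≫ k = t) {Z : C} {u : Z ⟶ X} {b : Z ⟶ B} (h : u ≫ a = b ≫ p)
    (l : Z ⟶ T) (hs : l ≫ s = u) (ht : l ≫ t = b) :
    (ofIsPullback H m hm).app u b h = l ≫ m := by
  dsimp only [ofIsPullback]
  congr 1
  apply H.hom_ext <;> simp [hs, ht]

/-- `ev` is the universal element of the pushforward of `k` along `p`. -/
def IsUniversal {P : C} {q : P ⟶ A} (ev : FiberMap p k q) : Prop :=
  ∀ ⦃X : C⦄ (a : X ⟶ A) (φ : FiberMap p k a), ∃! s : X ⟶ P, ∃ hs : s ≫ q = a,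
    ∀ ⦃Z : C⦄ (u : Z ⟶ X) (b : Z ⟶ B) (h : u ≫ a = b ≫ p),
      ev.app (u ≫ s) b (by rw [Category.assoc, hs, h]) = φ.app u b h

end FiberMap

/-- A map `m` over `B` out of the chosen pullback, as a family of maps on generalized elements. -/
noncomputable abbrev FiberMap.ofOver {C : Type u} [Category.{v} C] [HasPullbacks C] {A B K : C}
    {p : B ⟶ A} {k : K ⟶ B} {X : Over A} (m : (Over.pullback p).obj X ⟶ Over.mk k) :
    FiberMap p k X.hom :=
  .ofIsPullback (IsPullback.of_hasPullback X.hom p) m.left (Over.w m)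

/-- The pair of pullback projections is the generic element: equality there is equality of maps out
of the chosen pullback, and every other element factors through it. -/
theorem FiberMap.ofOver_universal_iff {C : Type u} [Category.{v} C] [HasPullbacks C]
    {A B K P : C} {p : B ⟶ A} {k : K ⟶ B} {q : P ⟶ A} (ev : FiberMap p k q)
    (e : (Over.pullback p).obj (Over.mk q) ⟶ Over.mk k)
    (he : e.left = ev.app (pullback.fst q p) (pullback.snd q p) pullback.condition)
    {X : Over A} (φ : FiberMap p k X.hom) (m : (Over.pullback p).obj X ⟶ Over.mk k)
    (hm : m.left = φ.app (pullback.fst X.hom p) (pullback.snd X.hom p) pullback.condition)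
    (s : X ⟶ Over.mk q) :
    (Over.pullback p).map s ≫ e = m ↔
      ∀ ⦃Z : C⦄ (u : Z ⟶ X.left) (b : Z ⟶ B) (h : u ≫ X.hom = b ≫ p),
        ev.app (u ≫ s.left) b
          (by rw [Category.assoc, show s.left ≫ q = X.hom from Over.w s, h]) = φ.app u b h := by
  have hs : s.left ≫ q = X.hom := Over.w s
  have key : ((Over.pullback p).map s ≫ e).left =
      ev.app (pullback.fst X.hom p ≫ s.left) (pullback.snd X.hom p)
        (by rw [Category.assoc, hs, pullback.condition]) := by
    rw [Over.comp_left, he]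
    exact (ev.app_eq_comp _ _ _ (pullback.lift_fst _ _ _) (pullback.lift_snd _ _ _)).symm
  constructor
  · intro h Z u b hub
    have h1 : pullback.lift u b hub ≫ pullback.fst X.hom p = u := pullback.lift_fst _ _ _
    have h2 : pullback.lift u b hub ≫ pullback.snd X.hom p = b := pullback.lift_snd _ _ _
    rw [φ.app_eq_comp pullback.condition hub _ h1 h2, ← hm, ← h, key]
    exact ev.app_eq_comp _ _ _ (by rw [← Category.assoc, h1]) h2
  · intro H
    apply Over.OverMorphism.ext
    rw [key, hm]
    exact H _ _ _

/-- Yoneda: a representation is the same as a universal element, the image of the identity of `q`.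
From here on pushforwards are used only in this form. -/
theorem isPushforward_iff {C : Type u} [Category.{v} C] [HasPullbacks C] {A B K P : C}
    (p : B ⟶ A) (k : K ⟶ B) (q : P ⟶ A) :
    IsPushforward p k q ↔ ∃ ev : FiberMap p k q, ev.IsUniversal := by
  have gen : ∀ {X : Over A} (m : (Over.pullback p).obj X ⟶ Over.mk k), m.left =
      (FiberMap.ofOver m).app (pullback.fst X.hom p) (pullback.snd X.hom p)
        pullback.condition := fun m =>
    ((FiberMap.ofIsPullback_app _ _ _ _ (𝟙 _) (by simp) (by simp)).trans
      (Category.id_comp _)).symm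
  constructor
  · rintro ⟨R⟩
    let e : (Over.pullback p).obj (Over.mk q) ⟶ Over.mk k := R.homEquiv (𝟙 (Over.mk q))
    have he : ∀ {X : Over A} (s : X ⟶ Over.mk q),
        R.homEquiv s = (Over.pullback p).map s ≫ e := fun s => by
      simpa using R.homEquiv_comp s (𝟙 _)
    refine ⟨.ofOver e, fun X a φ => ?_⟩
    let m : (Over.pullback p).obj (Over.mk a) ⟶ Over.mk k :=
      Over.homMk (φ.app (pullback.fst a p) (pullback.snd a p) pullback.condition)
        (φ.app_over _ _ _)
    have key := fun s : Over.mk a ⟶ Over.mk q =>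
      FiberMap.ofOver_universal_iff (.ofOver e) e (gen e) φ m rfl s
    refine ⟨(R.homEquiv.symm m).left, ⟨Over.w (R.homEquiv.symm m), ?_⟩, ?_⟩
    · refine (key _).1 ?_
      rw [← he]
      exact R.homEquiv.apply_symm_apply m
    · rintro s ⟨hs, H⟩
      have h1 := (key (Over.homMk s hs)).2 H
      rw [← he] at h1
      rw [← h1]
      exact (congrArg CommaMorphism.left (R.homEquiv.symm_apply_apply
        (Over.homMk s hs : Over.mk a ⟶ Over.mk q))).symm
  · rintro ⟨ev, hev⟩
    let e : (Over.pullback p).obj (Over.mk q) ⟶ Over.mk k :=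
      Over.homMk (ev.app (pullback.fst q p) (pullback.snd q p) pullback.condition)
        (ev.app_over _ _ _)
    have key := fun {X : Over A} (m : (Over.pullback p).obj X ⟶ Over.mk k)
      (s : X ⟶ Over.mk q) => FiberMap.ofOver_universal_iff ev e rfl (.ofOver m) m (gen m) s
    refine ⟨⟨fun {X} => Equiv.ofBijective
      (fun s : X ⟶ Over.mk q => ((Over.pullback p).map s ≫ e :
        (Over.pullback p).obj X ⟶ Over.mk k)) ⟨?_, ?_⟩, ?_⟩⟩
    · intro s s' hss
      exact Over.OverMorphism.ext ((hev X.hom (.ofOver _)).unique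
        ⟨Over.w s, (key _ s).1 hss⟩ ⟨Over.w s', (key _ s').1 rfl⟩)
    · intro m
      obtain ⟨t, ⟨ht, H⟩, -⟩ := hev X.hom (.ofOver m)
      exact ⟨Over.homMk t ht, (key m _).2 H⟩
    · intro X X' f g
      change (Over.pullback p).map (f ≫ g) ≫ e = (Over.pullback p).map f ≫
        (Over.pullback p).map g ≫ e
      simp

/-! ### Isomorphisms in inverse categories -/

section IsInverseCategory

variable {I : Type u} [Category.{v} I] [IsInverseCategory I]

/-- Degrees weakly decrease along every map. The inverse of the composite forces equality
throughout, so both factors are identities. -/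
theorem isIso_of_isIso_comp {i j l : I} (f : i ⟶ j) (g : j ⟶ l) [IsIso (f ≫ g)] :
    IsIso f ∧ IsIso g := by
  obtain ⟨deg, hdeg⟩ := IsInverseCategory.exists_degree (I := I)
  have le : ∀ {i j : I} (f : i ⟶ j), deg j ≤ deg i := fun {i j} f => by
    by_cases h : ∃ h : i = j, f = eqToHom h
    · rw [h.1]
    · exact (hdeg f h).le
  have iso : ∀ {i j : I} (f : i ⟶ j), deg i ≤ deg j → IsIso f := fun {i j} f hij => by
    by_cases h : ∃ h : i = j, f = eqToHom h
    · obtain ⟨rfl, rfl⟩ := h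
      infer_instance
    · exact absurd (hdeg f h) (not_lt.2 hij)
  have h1 := le (inv (f ≫ g))
  exact ⟨iso f (h1.trans (le g)), iso g ((le f).trans h1)⟩

/-- A non-identity isomorphism and its inverse would each lower the degree. This lets the boundary
be described by non-invertibility, a condition free of equalities between objects. -/
theorem isIso_iff_under_eq {i j : I} (f : i ⟶ j) : IsIso f ↔ Under.mk f = Under.mk (𝟙 i) := by
  obtain ⟨deg, hdeg⟩ := IsInverseCategory.exists_degree (I := I)
  constructor
  · intro hf
    by_cases h : ∃ h : i = j, f = eqToHom h
    · obtain ⟨rfl, rfl⟩ := h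
      rfl
    · by_cases h' : ∃ h : j = i, inv f = eqToHom h
      · obtain ⟨rfl, h'⟩ := h'
        have : f = 𝟙 _ := by
          have := IsIso.hom_inv_id f
          rw [h'] at this
          simpa using this
        exact absurd ⟨rfl, this⟩ h
      · exact absurd (hdeg f h) (hdeg _ h').asymm
  · intro h
    have : IsIso (Under.mk f).hom := by
      rw [h]
      exact inferInstanceAs (IsIso (𝟙 i))
    exact this

end IsInverseCategory

/-! ### Sections of the pushforward at a stage -/

section

variable {C : Type u} [Category.{v} C] {I : Type w} [SmallCategory I] {A B K : I ⥤ C}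

/-- The sections over `X` at stage `i` of the pushforward of `k` along `p`: a map `pt : X ⟶ A i`
together with a map `X ×_{A j} B j ⟶ K j` over `B j` for each `f : i ⟶ j`, naturally in `f`. -/
structure DiagSection (p : B ⟶ A) (k : K ⟶ B) (i : I) (X : C) where
  pt : X ⟶ A.obj i
  app : ∀ {j : I} (f : i ⟶ j), FiberMap (p.app j) (k.app j) (pt ≫ A.map f)
  naturality : ∀ {j l : I} (f : i ⟶ j) (g : j ⟶ l) {Z : C} (u : Z ⟶ X) (b : Z ⟶ B.obj j)
    (h : u ≫ pt ≫ A.map f = b ≫ p.app j),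
    (app f).app u b h ≫ K.map g = (app (f ≫ g)).app u (b ≫ B.map g) (by
      rw [Category.assoc, p.naturality, ← Category.assoc b, ← h]; simp)

namespace DiagSection

variable {p : B ⟶ A} {k : K ⟶ B} {i : I} {X : C}

/-- The type of `app` depends on `pt`; comparing values on elements avoids heterogeneous equality.
-/
theorem ext_app {σ τ : DiagSection p k i X} (hpt : σ.pt = τ.pt)
    (h : ∀ {j : I} (f : i ⟶ j) {Z : C} (u : Z ⟶ X) (b : Z ⟶ B.obj j)
      (hu : u ≫ σ.pt ≫ A.map f = b ≫ p.app j),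
      (σ.app f).app u b hu = (τ.app f).app u b (by rw [← hpt, hu])) : σ = τ := by
  obtain ⟨pt, φ, _⟩ := σ
  obtain ⟨pt', ψ, _⟩ := τ
  obtain rfl : pt = pt' := hpt
  have : @φ = @ψ := by
    funext j f
    have h1 := @h j f
    dsimp at h1
    cases hφ : φ f with
    | mk a _ _ => cases hψ : ψ f with
      | mk a' _ _ =>
        have : @a = @a' := by
          funext Z u b hu
          have := h1 u b hu
          rw [hφ, hψ] at this
          exact this
        subst this
        rfl
  subst this
  rfl

theorem app_congr {σ τ : DiagSection p k i X} (hστ : σ = τ) {j : I} {f g : i ⟶ j} (hfg : f = g)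
    {Z : C} {u u' : Z ⟶ X} {b b' : Z ⟶ B.obj j} (hu : u = u') (hb : b = b')
    (h : u ≫ σ.pt ≫ A.map f = b ≫ p.app j) :
    (σ.app f).app u b h = (τ.app g).app u' b' (by rw [← hστ, ← hfg, ← hu, ← hb, h]) := by
  subst hστ hfg hu hb; rfl

/-- The restriction of a section along a map of stages of definition. -/
def restrict (σ : DiagSection p k i X) {Y : C} (s : Y ⟶ X) : DiagSection p k i Y where
  pt := s ≫ σ.pt
  app f :=
    { app := fun u b h => (σ.app f).app (u ≫ s) b (by simpa using h)
      app_comp := fun g u b h => by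
        rw [← (σ.app f).app_comp]
        exact (σ.app f).app_congr (by simp) rfl _
      app_over := fun u b h => (σ.app f).app_over _ _ _ }
  naturality f g Z u b h := σ.naturality f g _ _ _

/-- The action of a map `g : i ⟶ j` on sections. -/
def push (σ : DiagSection p k i X) {j : I} (g : i ⟶ j) : DiagSection p k j X where
  pt := σ.pt ≫ A.map g
  app f :=
    { app := fun u b h => (σ.app (g ≫ f)).app u b (by simpa using h)
      app_comp := fun _ _ _ _ => (σ.app (g ≫ f)).app_comp _ _ _ _
      app_over := fun _ _ _ => (σ.app (g ≫ f)).app_over _ _ _ }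
  naturality f g' Z u b h := (σ.naturality _ _ _ _ _).trans
    (app_congr rfl (Category.assoc _ _ _) rfl rfl _)

theorem restrict_restrict (σ : DiagSection p k i X) {Y Z : C} (s : Y ⟶ X) (t : Z ⟶ Y) :
    (σ.restrict s).restrict t = σ.restrict (t ≫ s) :=
  ext_app (by simp [restrict]) fun f Z u b h => app_congr rfl rfl (Category.assoc _ _ _) rfl _

theorem restrict_id (σ : DiagSection p k i X) : σ.restrict (𝟙 X) = σ :=
  ext_app (by simp [restrict]) fun f Z u b h => app_congr rfl rfl (Category.comp_id _) rfl _

theorem push_restrict (σ : DiagSection p k i X) {j : I} (g : i ⟶ j) {Y : C} (s : Y ⟶ X) :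
    (σ.push g).restrict s = (σ.restrict s).push g :=
  ext_app (by simp [restrict, push]) fun f Z u b h => rfl

theorem push_push (σ : DiagSection p k i X) {j l : I} (g : i ⟶ j) (g' : j ⟶ l) :
    (σ.push g).push g' = σ.push (g ≫ g') :=
  ext_app (by simp [push]) fun f Z u b h => app_congr rfl (Category.assoc _ _ _).symm rfl rfl _

theorem push_id (σ : DiagSection p k i X) : σ.push (𝟙 i) = σ :=
  ext_app (by simp [push]) fun f Z u b h => app_congr rfl (Category.id_comp _) rfl rfl _

/-- Every section is a unique restriction of `σ`. -/
def IsUniversal (σ : DiagSection p k i X) : Prop :=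
  ∀ ⦃Y : C⦄ (τ : DiagSection p k i Y), ∃! s : Y ⟶ X, σ.restrict s = τ

theorem IsUniversal.hom_ext {σ : DiagSection p k i X} (hσ : σ.IsUniversal) {Y : C} {s t : Y ⟶ X}
    (h : σ.restrict s = σ.restrict t) : s = t :=
  (hσ _).unique h rfl

theorem IsUniversal.restrict_iso {σ : DiagSection p k i X} (hσ : σ.IsUniversal) {Y : C}
    (e : Y ⟶ X) [IsIso e] : (σ.restrict e).IsUniversal := by
  intro Z τ
  obtain ⟨s, rfl, hs⟩ := hσ τ
  refine ⟨s ≫ inv e, by simp [restrict_restrict], fun t ht => ?_⟩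
  beta_reduce at ht
  rw [restrict_restrict] at ht
  simp [← hs _ ht]

/-- Universal sections at varying stages form a functor. -/
theorem exists_functor_of_isUniversal {J : Type*} [Category* J] (Φ : J ⥤ I) (Q : J → C)
    (σ : ∀ j, DiagSection p k (Φ.obj j) (Q j)) (hσ : ∀ j, (σ j).IsUniversal) :
    ∃ (G : J ⥤ C) (τ : ∀ j, DiagSection p k (Φ.obj j) (G.obj j)), (∀ j, (τ j).IsUniversal) ∧
      ∀ {j j' : J} (g : j ⟶ j'), (τ j').restrict (G.map g) = (τ j).push (Φ.map g) := by
  -- The transition map along g classifies the push of the universal section along g; functoriality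
  -- then follows from uniqueness of classifying maps.
  choose m hm _ using fun (j j' : J) (g : j ⟶ j') => hσ j' ((σ j).push (Φ.map g))
  refine ⟨{ obj := Q, map := fun g => m _ _ g, map_id := ?_, map_comp := ?_ }, σ, hσ,
    fun g => hm _ _ g⟩
  · intro j
    apply (hσ j).hom_ext
    rw [hm, restrict_id, Φ.map_id, push_id]
  · intro j j' j'' f g
    apply (hσ j'').hom_ext
    rw [hm, ← restrict_restrict, hm, push_restrict, hm, push_push, Φ.map_comp]

end DiagSection

end

/-! ### Limits over cosieves; Reedy fibrations are levelwise fibrations -/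

theorem isPullback_of_existsUnique {C : Type u} [Category.{v} C] {P X Y Z : C} {fst : P ⟶ X}
    {snd : P ⟶ Y} {f : X ⟶ Z} {g : Y ⟶ Z} (w : fst ≫ f = snd ≫ g)
    (ex : ∀ ⦃T : C⦄ (a : T ⟶ X) (b : T ⟶ Y), a ≫ f = b ≫ g →
      ∃ l : T ⟶ P, l ≫ fst = a ∧ l ≫ snd = b)
    (uniq : ∀ ⦃T : C⦄ (l l' : T ⟶ P), l ≫ fst = l' ≫ fst → l ≫ snd = l' ≫ snd → l = l') :
    IsPullback fst snd f g := by
  choose l h1 h2 using ex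
  exact ⟨⟨w⟩, ⟨PullbackCone.IsLimit.mk w (fun s => l s.fst s.snd s.condition)
    (fun s => h1 _ _ _) (fun s => h2 _ _ _)
    (fun s m hm hm' => uniq _ _ (hm.trans (h1 _ _ _).symm) (hm'.trans (h2 _ _ _).symm))⟩⟩

section

variable {I : Type w} [SmallCategory I]

theorem under_eq_of_eqToHom {i : I} {h f : Under i} (e : h.right = f.right)
    (w : h.hom ≫ eqToHom e = f.hom) : h = f := by
  obtain ⟨⟨⟨⟩⟩, j, g⟩ := h
  obtain ⟨⟨⟨⟩⟩, j', g'⟩ := f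
  change j = j' at e
  subst e
  obtain rfl : g = g' := (Category.comp_id g).symm.trans w
  rfl

theorem finite_under [FinCategory I] (i : I) : Finite (Under i) :=
  Finite.of_injective (β := Σ j : I, (i ⟶ j)) (fun f => ⟨f.right, f.hom⟩) (by
    rintro ⟨⟨⟨⟩⟩, j, f⟩ ⟨⟨⟨⟩⟩, j', f'⟩ h
    simp only [Sigma.mk.injEq] at h
    obtain ⟨rfl, h⟩ := h
    obtain rfl := eq_of_heq h
    rfl)

theorem hasLimitsOfShape_fullSubcategory_under [FinCategory I] {C : Type u} [Category.{v} C]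
    [HasFiniteLimits C] {i : I} (S : ObjectProperty (Under i)) :
    HasLimitsOfShape S.FullSubcategory C := by
  have := finite_under i
  have : Finite S.FullSubcategory := Finite.of_injective (fun f => f.obj) (by
    rintro ⟨a, _⟩ ⟨b, _⟩ h; cases h; rfl)
  have : ∀ f g : S.FullSubcategory, Finite (f ⟶ g) := fun f g =>
    Finite.of_injective (fun a => (S.ι ⋙ Under.forget i).map a) (by
      intro a b h
      exact InducedCategory.hom_ext (Under.UnderMorphism.ext h))
  let _ : FinCategory S.FullSubcategory :=
    { fintypeObj := Fintype.ofFinite _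
      fintypeHom := fun _ _ => Fintype.ofFinite _ }
  infer_instance

variable [FinCategory I] [IsInverseCategory I] {C : Type u} [Category.{v} C] [HasFiniteLimits C]

attribute [local instance] hasLimitsOfShape_fullSubcategory_under

omit [IsInverseCategory I] in
theorem matchingObj_hom_ext {X : I ⥤ C} {i : I} {Z : C} {a b : Z ⟶ matchingObj X i}
    (h : ∀ g, a ≫ matchingObjProj X i g = b ≫ matchingObjProj X i g) : a = b :=
  limit.hom_ext h

omit [IsInverseCategory I] in
theorem relativeMatchingMap_fst {X Y : I ⥤ C} (p : X ⟶ Y) (i : I) :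
    relativeMatchingMap p i ≫ pullback.fst _ _ = p.app i :=
  pullback.lift_fst _ _ _

omit [IsInverseCategory I] in
theorem relativeMatchingMap_snd {X Y : I ⥤ C} (p : X ⟶ Y) (i : I) :
    relativeMatchingMap p i ≫ pullback.snd _ _ = matchingMap X i :=
  pullback.lift_snd _ _ _

omit [IsInverseCategory I] in
theorem relativeMatchingMap_snd_assoc {X Y : I ⥤ C} (p : X ⟶ Y) (i : I) {Z : C}
    (h : matchingObj X i ⟶ Z) :
    relativeMatchingMap p i ≫ pullback.snd _ _ ≫ h = matchingMap X i ≫ h := by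
  rw [← Category.assoc, relativeMatchingMap_snd]

/-- The limit of `X` over a full subcategory `S` of `i/I`. -/
noncomputable abbrev partialMatchingObj {i : I} (S : ObjectProperty (Under i)) (X : I ⥤ C) : C :=
  limit ((S.ι ⋙ Under.forget i) ⋙ X)

/-- The projections of `partialMatchingObj`. -/
noncomputable abbrev partialMatchingObjProj {i : I} (S : ObjectProperty (Under i)) (X : I ⥤ C)
    (h : Under i) (hS : S h) : partialMatchingObj S X ⟶ X.obj h.right :=
  limit.π ((S.ι ⋙ Under.forget i) ⋙ X) (⟨h, hS⟩ : S.FullSubcategory)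

/-- The functoriality of `partialMatchingObj` in the diagram. -/
noncomputable abbrev partialMatchingObjMap {i : I} (S : ObjectProperty (Under i)) {X Y : I ⥤ C}
    (p : X ⟶ Y) : partialMatchingObj S X ⟶ partialMatchingObj S Y :=
  limMap (Functor.whiskerLeft (S.ι ⋙ Under.forget i) p)

omit [IsInverseCategory I] in
theorem partialMatchingObjMap_proj {i : I} (S : ObjectProperty (Under i)) {X Y : I ⥤ C}
    (p : X ⟶ Y) (h : Under i) (hS : S h) :
    partialMatchingObjMap S p ≫ partialMatchingObjProj S Y h hS =
      partialMatchingObjProj S X h hS ≫ p.app h.right :=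
  limMap_π _ _

omit [IsInverseCategory I] in
theorem partialMatchingObjProj_map {i : I} (S : ObjectProperty (Under i)) (X : I ⥤ C)
    {h h' : Under i} (hS : S h) (hS' : S h') (a : h ⟶ h') :
    partialMatchingObjProj S X h hS ≫ X.map a.right = partialMatchingObjProj S X h' hS' :=
  limit.w ((S.ι ⋙ Under.forget i) ⋙ X)
    (ObjectProperty.homMk a : (⟨h, hS⟩ : S.FullSubcategory) ⟶ ⟨h', hS'⟩)

omit [IsInverseCategory I] in
theorem partialMatchingObj_hom_ext {i : I} {S : ObjectProperty (Under i)} {X : I ⥤ C} {Z : C}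
    {a b : Z ⟶ partialMatchingObj S X} (hab : ∀ h hS,
      a ≫ partialMatchingObjProj S X h hS = b ≫ partialMatchingObjProj S X h hS) : a = b :=
  limit.hom_ext fun h => hab h.obj h.property

omit [IsInverseCategory I] in
theorem partialMatchingObj_exists_lift {i : I} {S : ObjectProperty (Under i)} {X : I ⥤ C} {Z : C}
    (c : ∀ h : Under i, S h → (Z ⟶ X.obj h.right))
    (hc : ∀ {h h' : Under i} (hS : S h) (hS' : S h') (a : h ⟶ h'),
      c h hS ≫ X.map a.right = c h' hS') :
    ∃ l : Z ⟶ partialMatchingObj S X, ∀ h hS, l ≫ partialMatchingObjProj S X h hS = c h hS :=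
  ⟨limit.lift ((S.ι ⋙ Under.forget i) ⋙ X)
    { pt := Z
      π :=
        { app := fun h => c h.obj h.property
          naturality := fun h h' a => by
            simpa using (hc h.property h'.property a.hom).symm } },
    fun h hS => limit.lift_π _ _⟩

/-- Since no other object of S maps to f, and f has no non-identity endomorphism, the only
compatibilities involving f are those along maps out of f. -/
theorem comp_partialMatching_extend {i : I} {S : ObjectProperty (Under i)} {X : I ⥤ C} {Z : C}
    {f : Under i} (hf : ∀ h, S h → h ≠ f → IsEmpty (h ⟶ f))
    (c : Z ⟶ X.obj f.right) (x : ∀ h : Under i, S h → h ≠ f → (Z ⟶ X.obj h.right))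
    (hx : ∀ {h h' : Under i} (hS : S h) (hS' : S h') (hh : h ≠ f) (hh' : h' ≠ f) (a : h ⟶ h'),
      x h hS hh ≫ X.map a.right = x h' hS' hh')
    (hcx : ∀ {h : Under i} (hS : S h) (hh : h ≠ f) (a : f ⟶ h), c ≫ X.map a.right = x h hS hh)
    (hfS : S f) :
    ∃ l : Z ⟶ partialMatchingObj S X, l ≫ partialMatchingObjProj S X f hfS = c ∧
      ∀ h hS hh, l ≫ partialMatchingObjProj S X h hS = x h hS hh := by
  classical
  obtain ⟨l, hl⟩ := partialMatchingObj_exists_lift (S := S) (X := X)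
    (fun h hS => if e : h = f then c ≫ X.map (eqToHom (congrArg Comma.right e.symm))
      else x h hS e) (by
    intro h h' hS hS' a
    by_cases e : h = f
    · subst e
      by_cases e' : h' = h
      · subst e'
        have : a.right = 𝟙 _ := by
          obtain ⟨deg, hdeg⟩ := IsInverseCategory.exists_degree (I := I)
          by_contra hne
          refine (hdeg a.right ?_).false
          rintro ⟨_, h⟩
          exact hne h
        simp [this]
      · simpa [e'] using hcx hS' e' a
    · by_cases e' : h' = f
      · subst e'
        exact ((hf h hS e).false a).elim
      · simpa [e, e'] using hx hS hS' e e' a)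
  exact ⟨l, by simp [hl], fun h hS hh => by simp [hl, hh]⟩

/-- Limits over cosieves in `i/I` take Reedy fibrations to fibrations. -/
theorem partialMatchingObjMap_mem (F : MorphismProperty C) [F.IsMultiplicative]
    [F.IsStableUnderBaseChange] {X Y : I ⥤ C} {p : X ⟶ Y} (hp : reedyFibrations F p) {i : I} :
    ∀ (n : ℕ) (S : ObjectProperty (Under i)), Set.ncard {h | S h} = n →
      (∀ ⦃h h' : Under i⦄, (h ⟶ h') → S h → S h') → F (partialMatchingObjMap S p) := by
  have := finite_under i
  obtain ⟨deg, hdeg⟩ := IsInverseCategory.exists_degree (I := I)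
  intro n
  induction n with
  | zero =>
    intro S hS _
    rw [Set.ncard_eq_zero] at hS
    have hS' : ∀ h, ¬ S h := fun h hh => by
      have : h ∈ {h | S h} := hh
      rw [hS] at this
      exact this
    obtain ⟨l, -⟩ := partialMatchingObj_exists_lift (S := S) (X := X)
      (Z := partialMatchingObj S Y) (fun h hh => (hS' h hh).elim) (fun hh => (hS' _ hh).elim)
    have : IsIso (partialMatchingObjMap S p) :=
      ⟨l, partialMatchingObj_hom_ext fun h hh => (hS' h hh).elim,
        partialMatchingObj_hom_ext fun h hh => (hS' h hh).elim⟩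
    exact F.of_isIso _
  | succ n ih =>
    intro S hn hS
    -- An object of maximal degree receives no map from any other object of S, so removing it leaves
    -- a cosieve with one element fewer.
    obtain ⟨f, hfS, hmax⟩ := Set.exists_max_image {h | S h} (fun h : Under i => deg h.right)
      (Set.toFinite _) (Set.nonempty_of_ncard_ne_zero (by omega))
    have hf : ∀ h, S h → h ≠ f → IsEmpty (h ⟶ f) := fun h hh hne => ⟨fun a => by
      refine absurd (hmax h hh) (not_le.2 (hdeg a.right ?_))
      rintro ⟨e, ha⟩
      exact hne (under_eq_of_eqToHom e (by rw [← ha, Under.w a]))⟩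
    let S' : ObjectProperty (Under i) := fun h => S h ∧ h ≠ f
    have hS' : ∀ ⦃h h' : Under i⦄, (h ⟶ h') → S' h → S' h' := by
      rintro h h' a ⟨hh, hne⟩
      refine ⟨hS a hh, ?_⟩
      rintro rfl
      exact (hf h hh hne).false a
    have hn' : Set.ncard {h | S' h} = n := by
      have : {h | S' h} = {h | S h} \ {f} := rfl
      rw [this, Set.ncard_sdiff_singleton_of_mem hfS, hn]
      rfl
    have ihS := ih S' hn' hS'
    have res : ∀ V : I ⥤ C, ∃ ρ : partialMatchingObj S V ⟶ partialMatchingObj S' V,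
        ∀ h hh, ρ ≫ partialMatchingObjProj S' V h hh = partialMatchingObjProj S V h hh.1 :=
      fun V => partialMatchingObj_exists_lift _ fun hh hh' a =>
        partialMatchingObjProj_map S V hh.1 hh'.1 a
    obtain ⟨ρX, hρX⟩ := res X
    obtain ⟨ρY, hρY⟩ := res Y
    have hsq : partialMatchingObjMap S p ≫ ρY = ρX ≫ partialMatchingObjMap S' p :=
      partialMatchingObj_hom_ext fun h hh => by
        rw [Category.assoc, hρY, Category.assoc, partialMatchingObjMap_proj,
          partialMatchingObjMap_proj, ← Category.assoc, hρX]
    obtain ⟨t, ht1, ht2⟩ : ∃ t : partialMatchingObj S X ⟶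
        pullback ρY (partialMatchingObjMap S' p),
        t ≫ pullback.fst _ _ = partialMatchingObjMap S p ∧ t ≫ pullback.snd _ _ = ρX :=
      ⟨pullback.lift _ _ hsq, pullback.lift_fst _ _ _, pullback.lift_snd _ _ _⟩
    have hbd : ∀ g : Boundary f.right, S' (Under.mk (f.hom ≫ g.obj.hom)) := fun g => by
      refine ⟨hS (Under.homMk g.obj.hom) hfS, fun e => g.property ?_⟩
      have : IsIso g.obj.hom := by
        by_contra hiso
        refine (hdeg g.obj.hom ?_).ne (congrArg (fun h : Under i => deg h.right) e)
        rintro ⟨e1, e2⟩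
        apply hiso
        rw [e2]
        infer_instance
      exact (isIso_iff_under_eq g.obj.hom).1 this
    -- Composing f with a non-identity map lands in S', so the limit over S' restricts to the
    -- matching object at the target of f.
    let ν : partialMatchingObj S' X ⟶ matchingObj X f.right :=
      limit.lift (Boundary.proj f.right ⋙ X)
        { pt := partialMatchingObj S' X
          π :=
            { app := fun g => partialMatchingObjProj S' X (Under.mk (f.hom ≫ g.obj.hom)) (hbd g)
              naturality := fun g g' a => by
                have := partialMatchingObjProj_map S' X (hbd g) (hbd g')
                  (Under.homMk a.hom.right (by simp))
                simpa using this.symm } }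
    have hν : ∀ g, ν ≫ matchingObjProj X f.right g = partialMatchingObjProj S' X _ (hbd g) :=
      fun g => limit.lift_π _ _
    obtain ⟨b, hb1, hb2⟩ : ∃ b : pullback ρY (partialMatchingObjMap S' p) ⟶
        pullback (matchingMap Y f.right) (matchingObjMap p f.right),
        b ≫ pullback.fst _ _ = pullback.fst _ _ ≫ partialMatchingObjProj S Y f hfS ∧
        b ≫ pullback.snd _ _ = pullback.snd _ _ ≫ ν := by
      refine ⟨pullback.lift _ _ ?_, pullback.lift_fst _ _ _, pullback.lift_snd _ _ _⟩
      refine matchingObj_hom_ext fun g => ?_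
      rw [Category.assoc, Category.assoc, matchingMap_proj, Category.assoc, Category.assoc,
        matchingObjMap_proj, reassoc_of% hν]
      have h1 : partialMatchingObjProj S Y f hfS ≫ Y.map g.obj.hom = _ :=
        partialMatchingObjProj_map S Y hfS (hbd g).1 (Under.homMk g.obj.hom)
      rw [h1, ← hρY _ (hbd g), ← Category.assoc, pullback.condition, Category.assoc,
        partialMatchingObjMap_proj]
      rfl
    -- Adding f to S' adds just a component in X over its already given boundary. Hence the gap map
    -- `t` is a pullback of the relative matching map at f, and the map of limits over S is `t`
    -- followed by a pullback of the map of limits over S'.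
    have hpb : IsPullback (partialMatchingObjProj S X f hfS) t
        (relativeMatchingMap p f.right) b := by
      refine isPullback_of_existsUnique ?_ ?_ ?_
      · apply pullback.hom_ext
        · rw [Category.assoc, Category.assoc, relativeMatchingMap_fst, hb1, reassoc_of% ht1]
          exact (partialMatchingObjMap_proj S p f hfS).symm
        · rw [Category.assoc, Category.assoc, relativeMatchingMap_snd, hb2, reassoc_of% ht2]
          refine matchingObj_hom_ext fun g => ?_
          rw [Category.assoc, matchingMap_proj, Category.assoc, hν, hρX]
          exact partialMatchingObjProj_map S X hfS (hbd g).1 (Under.homMk g.obj.hom)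
      · intro T c d hcd
        obtain ⟨l, hl1, hl2⟩ := comp_partialMatching_extend hf c
          (fun h hh hne => d ≫ pullback.snd _ _ ≫ partialMatchingObjProj S' X h ⟨hh, hne⟩)
          (by
            intro h h' hh hh' hne hne' a
            simp only [Category.assoc]
            rw [partialMatchingObjProj_map S' X ⟨hh, hne⟩ ⟨hh', hne'⟩ a])
          (by
            intro h hh hne a
            have ha : Under.mk a.right ≠ Under.mk (𝟙 f.right) := by
              intro e
              have := (isIso_iff_under_eq a.right).2 e
              exact (hf h hh hne).false (Under.homMk (inv a.right) (by
                rw [← Under.w a, Category.assoc, IsIso.hom_inv_id, Category.comp_id]))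
            have h1 := congrArg (fun z => z ≫ pullback.snd _ _ ≫
              matchingObjProj X f.right ⟨Under.mk a.right, ha⟩) hcd
            simp only [Category.assoc, relativeMatchingMap_snd_assoc, matchingMap_proj,
              reassoc_of% hb2, hν] at h1
            have h2 := partialMatchingObjProj_map S' X (hbd ⟨Under.mk a.right, ha⟩) ⟨hh, hne⟩
              (Under.homMk (𝟙 _) (by simp))
            rw [← h2]
            simpa using h1) hfS
        have hl3 : l ≫ ρX = d ≫ pullback.snd _ _ := partialMatchingObj_hom_ext fun h hh => by
          rw [Category.assoc, hρX, hl2 _ _ hh.2, Category.assoc]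
        refine ⟨l, hl1, pullback.hom_ext ?_ ?_⟩
        · rw [Category.assoc, ht1]
          refine partialMatchingObj_hom_ext fun h hh => ?_
          rw [Category.assoc, partialMatchingObjMap_proj]
          by_cases e : h = f
          · subst e
            rw [reassoc_of% hl1]
            have h1 := congrArg (fun z => z ≫ pullback.fst _ _) hcd
            simpa [relativeMatchingMap_fst, hb1] using h1
          · rw [← hρY h ⟨hh, e⟩, ← hρX h ⟨hh, e⟩, Category.assoc, Category.assoc,
              pullback.condition_assoc,
              reassoc_of% hl3, partialMatchingObjMap_proj]
        · simpa [ht2] using hl3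
      · intro T l l' h1 h2
        refine partialMatchingObj_hom_ext fun h hh => ?_
        by_cases e : h = f
        · subst e
          exact h1
        · have h3 := congrArg (fun z => z ≫ pullback.snd _ _ ≫
            partialMatchingObjProj S' X h ⟨hh, e⟩) h2
          simpa [reassoc_of% ht2, hρX] using h3
    have ht : F t := F.of_isPullback hpb (hp f.right)
    have := F.comp_mem _ _ ht (F.pullback_fst ρY _ ihS)
    simpa [ht1] using this

/-- The boundary is a cosieve: if f followed by a map is invertible, then so is f. -/
theorem matchingObjMap_mem (F : MorphismProperty C) [F.IsMultiplicative]
    [F.IsStableUnderBaseChange] {X Y : I ⥤ C} {p : X ⟶ Y} (hp : reedyFibrations F p) (i : I) :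
    F (matchingObjMap p i) := by
  refine partialMatchingObjMap_mem F hp _ _ rfl ?_
  rintro ⟨⟨⟨⟩⟩, j, f⟩ ⟨⟨⟨⟩⟩, j', f'⟩ a hf e
  apply hf
  have h1 : IsIso f' := (isIso_iff_under_eq f').2 e
  have h2 : f ≫ a.right = f' := Under.w a
  have : IsIso (f ≫ a.right) := by rwa [h2]
  exact (isIso_iff_under_eq f).1 (isIso_of_isIso_comp f a.right).1

/-- Reedy fibrations are levelwise fibrations. -/
theorem app_mem_of_reedyFibrations (F : MorphismProperty C) [F.IsMultiplicative]
    [F.IsStableUnderBaseChange] {X Y : I ⥤ C} {p : X ⟶ Y} (hp : reedyFibrations F p) (i : I) :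
    F (p.app i) := by
  have := F.comp_mem _ _ (hp i) (F.pullback_fst (matchingMap Y i) _ (matchingObjMap_mem F hp i))
  simpa [relativeMatchingMap_fst] using this

end

/-! ### Components of sections at the identity -/

namespace DiagSection

variable {C : Type u} [Category.{v} C] {I : Type w} [SmallCategory I] {A B K : I ⥤ C}
  {p : B ⟶ A} {k : K ⟶ B} {i : I} {X : C}

/-- The component of a section at the identity. -/
def eval (σ : DiagSection p k i X) : FiberMap (p.app i) (k.app i) σ.pt where
  app u b h := (σ.app (𝟙 i)).app u b (by simpa using h)
  app_comp _ _ _ _ := (σ.app (𝟙 i)).app_comp _ _ _ _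
  app_over _ _ _ := (σ.app (𝟙 i)).app_over _ _ _

theorem eval_restrict (σ : DiagSection p k i X) {Y Z : C} (s : Y ⟶ X) (u : Z ⟶ Y)
    (b : Z ⟶ B.obj i) (h : u ≫ (σ.restrict s).pt = b ≫ p.app i) :
    (σ.restrict s).eval.app u b h = σ.eval.app (u ≫ s) b ((Category.assoc _ _ _).trans h) :=
  rfl

/-- Every component of a section is thus the identity component of one of its pushes, so knowing the
pushes along non-invertible maps determines all the corresponding components. -/
theorem eval_push (σ : DiagSection p k i X) {j : I} (g : i ⟶ j) {Z : C} (u : Z ⟶ X)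
    (b : Z ⟶ B.obj j) (h : u ≫ (σ.push g).pt = b ≫ p.app j) :
    (σ.push g).eval.app u b h = (σ.app g).app u b h :=
  app_congr rfl (Category.comp_id _) rfl rfl _

theorem eval_congr {σ τ : DiagSection p k i X} (hστ : σ = τ)
    {Z : C} {u u' : Z ⟶ X} {b b' : Z ⟶ B.obj i} (hu : u = u') (hb : b = b')
    (h : u ≫ σ.pt = b ≫ p.app i) :
    σ.eval.app u b h = τ.eval.app u' b' (by rw [← hστ, ← hu, ← hb, h]) := by
  subst hστ hu hb; rfl

theorem comp_map_eq {j l : I} (f : i ⟶ j) (g : j ⟶ l) {Z : C} {a : X ⟶ A.obj i} {u : Z ⟶ X}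
    {b : Z ⟶ B.obj j} (h : u ≫ a ≫ A.map f = b ≫ p.app j) :
    u ≫ a ≫ A.map (f ≫ g) = (b ≫ B.map g) ≫ p.app l := by
  rw [Category.assoc, p.naturality, ← Category.assoc b, ← h]
  simp

theorem comp_map_eq_of_eq {j : I} (f : i ⟶ j) {Z : C} {a : X ⟶ A.obj i} {u : Z ⟶ X}
    {b : Z ⟶ B.obj i} (h : u ≫ a = b ≫ p.app i) :
    u ≫ a ≫ A.map f = (b ≫ B.map f) ≫ p.app j := by
  rw [Category.assoc, p.naturality, ← Category.assoc b, ← h]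
  simp

/-- Naturality out of the identity: this is the only constraint tying the identity component to the
boundary components. -/
theorem eval_map (σ : DiagSection p k i X) {j : I} (g : i ⟶ j) {Z : C} (u : Z ⟶ X)
    (b : Z ⟶ B.obj i) (h : u ≫ σ.pt = b ≫ p.app i) :
    σ.eval.app u b h ≫ K.map g = (σ.app g).app u (b ≫ B.map g) (comp_map_eq_of_eq g h) :=
  (σ.naturality (𝟙 i) g u b _).trans (app_congr rfl (Category.id_comp _) rfl rfl _)

end DiagSection

/-! ### Extending universal sections from the boundary -/

section

variable {I : Type w} [SmallCategory I] [FinCategory I] [IsInverseCategory I]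
  {C : Type u} [Category.{v} C] [HasFiniteLimits C] {A B K : I ⥤ C} {p : B ⟶ A} {k : K ⟶ B}

/-- The point of `i/I` given by a non-invertible map, as an element of the boundary. -/
def Boundary.mk {i j : I} (f : i ⟶ j) (hf : ¬ IsIso f) : Boundary i :=
  ⟨Under.mk f, fun h => hf ((isIso_iff_under_eq f).2 h)⟩

/-- Composition as a map in the boundary. -/
def Boundary.homMk {i j l : I} (f : i ⟶ j) (g : j ⟶ l) (hf : ¬ IsIso f) (hfg : ¬ IsIso (f ≫ g)) :
    Boundary.mk f hf ⟶ Boundary.mk (f ≫ g) hfg :=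
  ObjectProperty.homMk (Under.homMk g)

omit [FinCategory I] in
theorem Boundary.not_isIso {i : I} (g : Boundary i) : ¬ IsIso g.obj.hom :=
  fun h => g.property ((isIso_iff_under_eq g.obj.hom).1 h)

omit [IsInverseCategory I] in
theorem relativeMatching_hom_ext {i : I} {Q : Boundary i ⥤ C} {q : limit Q ⟶ matchingObj A i}
    {Z : C} {a b : Z ⟶ pullback (matchingMap A i) q}
    (h1 : a ≫ pullback.fst _ _ = b ≫ pullback.fst _ _)
    (h2 : ∀ g, a ≫ pullback.snd _ _ ≫ limit.π Q g = b ≫ pullback.snd _ _ ≫ limit.π Q g) :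
    a = b :=
  pullback.hom_ext h1 (limit.hom_ext fun g => by simpa using h2 g)

omit [IsInverseCategory I] in
theorem relativeMatching_exists_lift {i : I} {Q : Boundary i ⥤ C} {q : limit Q ⟶ matchingObj A i}
    {r : ∀ g : Boundary i, Q.obj g ⟶ A.obj g.obj.right}
    (hq : ∀ g, q ≫ matchingObjProj A i g = limit.π Q g ≫ r g) {Z : C} (a : Z ⟶ A.obj i)
    (t : ∀ g, Z ⟶ Q.obj g) (ht : ∀ {g g' : Boundary i} (m : g ⟶ g'), t g ≫ Q.map m = t g')
    (hat : ∀ g, a ≫ A.map g.obj.hom = t g ≫ r g) :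
    ∃ l : Z ⟶ pullback (matchingMap A i) q, l ≫ pullback.fst _ _ = a ∧
      ∀ g, l ≫ pullback.snd _ _ ≫ limit.π Q g = t g := by
  let T : Z ⟶ limit Q := limit.lift Q
    { pt := Z, π := { app := t, naturality := fun g g' m => by simpa using (ht m).symm } }
  have hT : ∀ g, T ≫ limit.π Q g = t g := fun g => limit.lift_π _ _
  refine ⟨pullback.lift a T (matchingObj_hom_ext fun g => ?_), pullback.lift_fst _ _ _,
    fun g => ?_⟩
  · rw [Category.assoc, matchingMap_proj, Category.assoc, hq, reassoc_of% hT, hat]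
  · rw [pullback.lift_snd_assoc, hT]

/-- `D`, with the maps `dA` and `dQ`, represents pairs of a generalized element of `A i` and a
compatible family of generalized elements of the objects `Qo f`, for non-invertible `f : i ⟶ j`,
agreeing in `A j`. -/
structure IsRelativeMatching {i : I} (A : I ⥤ C) (Qo : ∀ {j : I} (f : i ⟶ j), ¬ IsIso f → C)
    (Qm : ∀ {j l : I} (f : i ⟶ j) (g : j ⟶ l) (hf : ¬ IsIso f) (hfg : ¬ IsIso (f ≫ g)),
      Qo f hf ⟶ Qo (f ≫ g) hfg)
    (r : ∀ {j : I} (f : i ⟶ j) (hf : ¬ IsIso f), Qo f hf ⟶ A.obj j)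
    {D : C} (dA : D ⟶ A.obj i) (dQ : ∀ {j : I} (f : i ⟶ j) (hf : ¬ IsIso f), D ⟶ Qo f hf) :
    Prop where
  map : ∀ {j l : I} (f : i ⟶ j) (g : j ⟶ l) (hf : ¬ IsIso f) (hfg : ¬ IsIso (f ≫ g)),
    dQ f hf ≫ Qm f g hf hfg = dQ (f ≫ g) hfg
  w : ∀ {j : I} (f : i ⟶ j) (hf : ¬ IsIso f), dA ≫ A.map f = dQ f hf ≫ r f hf
  exists_lift : ∀ {Z : C} (a : Z ⟶ A.obj i)
    (t : ∀ {j : I} (f : i ⟶ j) (hf : ¬ IsIso f), Z ⟶ Qo f hf),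
    (∀ {j l : I} (f : i ⟶ j) (g : j ⟶ l) (hf : ¬ IsIso f) (hfg : ¬ IsIso (f ≫ g)),
      t f hf ≫ Qm f g hf hfg = t (f ≫ g) hfg) →
    (∀ {j : I} (f : i ⟶ j) (hf : ¬ IsIso f), a ≫ A.map f = t f hf ≫ r f hf) →
    ∃ l : Z ⟶ D, l ≫ dA = a ∧ ∀ {j : I} (f : i ⟶ j) (hf : ¬ IsIso f), l ≫ dQ f hf = t f hf
  hom_ext : ∀ {Z : C} {l l' : Z ⟶ D}, l ≫ dA = l' ≫ dA →
    (∀ {j : I} (f : i ⟶ j) (hf : ¬ IsIso f), l ≫ dQ f hf = l' ≫ dQ f hf) → l = l'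

/-- Used twice: for A and the representing objects it gives the base D, and for B and K it gives the
codomain of the relative matching map of k. -/
theorem isRelativeMatching_pullback {i : I} (Q : Boundary i ⥤ C) (q : limit Q ⟶ matchingObj A i)
    (r : ∀ g : Boundary i, Q.obj g ⟶ A.obj g.obj.right)
    (hq : ∀ g, q ≫ matchingObjProj A i g = limit.π Q g ≫ r g) :
    IsRelativeMatching A (fun f hf => Q.obj (Boundary.mk f hf))
      (fun f g hf hfg => Q.map (Boundary.homMk f g hf hfg)) (fun f hf => r (Boundary.mk f hf))
      (pullback.fst (matchingMap A i) q)
      (fun f hf => pullback.snd (matchingMap A i) q ≫ limit.π Q (Boundary.mk f hf)) where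
  map f g hf hfg := by rw [Category.assoc, limit.w]
  w f hf := by
    have h1 := hq (Boundary.mk f hf)
    have h2 := matchingMap_proj A i (Boundary.mk f hf)
    refine Eq.trans (congrArg (pullback.fst (matchingMap A i) q ≫ ·) h2).symm ?_
    refine Eq.trans (pullback.condition_assoc _) ?_
    exact (congrArg (pullback.snd (matchingMap A i) q ≫ ·) h1).trans (Category.assoc _ _ _).symm
  exists_lift {Z} a t ht hat := by
    -- A map of the boundary has a commuting triangle as a proof, not a literal composite as target;
    -- substituting that equation reduces to the hypothesis `ht`.
    have key : ∀ {j l : I} (f : i ⟶ j) (n : j ⟶ l) (g : i ⟶ l) (w : f ≫ n = g)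
        (hf : ¬ IsIso f) (hg : ¬ IsIso g), t f hf ≫ Q.map (ObjectProperty.homMk
          (Under.homMk n w) : Boundary.mk f hf ⟶ Boundary.mk g hg) = t g hg := by
      intro j l f n g w hf hg
      subst w
      exact ht f n hf hg
    obtain ⟨l, hl, hl'⟩ := relativeMatching_exists_lift hq a
      (fun g => t g.obj.hom g.not_isIso)
      (fun m => key _ m.hom.right _ (Under.w m.hom) _ _) (fun g => hat g.obj.hom g.not_isIso)
    exact ⟨l, hl, fun f hf => hl' (Boundary.mk f hf)⟩
  hom_ext h h' := relativeMatching_hom_ext h fun g => h' g.obj.hom g.not_isIso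

omit [FinCategory I] in
/-- Universal sections on the boundary of `i` extend to a universal section at `i`, over a
fibration into the object `D` classifying a point of `A i` and a compatible family of sections on
the boundary. -/
theorem exists_universal_of_isRelativeMatching (F : MorphismProperty C) [F.IsMultiplicative]
    [F.IsStableUnderBaseChange] (hF : StableUnderPushforward F) {i : I} (hp : F (p.app i))
    {W : C} {R : K.obj i ⟶ W} (hR : F R) {wB : W ⟶ B.obj i}
    {wK : ∀ {j : I} (f : i ⟶ j), ¬ IsIso f → (W ⟶ K.obj j)}
    (hW : IsRelativeMatching B (fun {j} _ _ => K.obj j) (fun _ g _ _ => K.map g)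
      (fun {j} _ _ => k.app j) wB wK)
    (hRB : R ≫ wB = k.app i)
    (hRK : ∀ {j : I} (f : i ⟶ j) (hf : ¬ IsIso f), R ≫ wK f hf = K.map f)
    {Qo : ∀ {j : I} (f : i ⟶ j), ¬ IsIso f → C}
    {Qm : ∀ {j l : I} (f : i ⟶ j) (g : j ⟶ l) (hf : ¬ IsIso f) (hfg : ¬ IsIso (f ≫ g)),
      Qo f hf ⟶ Qo (f ≫ g) hfg}
    {σ : ∀ {j : I} (f : i ⟶ j) (hf : ¬ IsIso f), DiagSection p k j (Qo f hf)}
    (hσ : ∀ {j : I} (f : i ⟶ j) (hf : ¬ IsIso f), (σ f hf).IsUniversal)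
    (hσn : ∀ {j l : I} (f : i ⟶ j) (g : j ⟶ l) (hf : ¬ IsIso f) (hfg : ¬ IsIso (f ≫ g)),
      (σ (f ≫ g) hfg).restrict (Qm f g hf hfg) = (σ f hf).push g)
    {D : C} {dA : D ⟶ A.obj i} {dQ : ∀ {j : I} (f : i ⟶ j) (hf : ¬ IsIso f), D ⟶ Qo f hf}
    (hD : IsRelativeMatching A Qo Qm (fun f hf => (σ f hf).pt) dA dQ) :
    ∃ (P : C) (π : P ⟶ D) (τ : DiagSection p k i P), F π ∧
      τ.IsUniversal ∧ τ.pt = π ≫ dA ∧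
      ∀ {j : I} (f : i ⟶ j) (hf : ¬ IsIso f), (σ f hf).restrict (π ≫ dQ f hf) = τ.push f := by
  have not_comp : ∀ {j l : I} {f : i ⟶ j} (g : j ⟶ l), ¬ IsIso f → ¬ IsIso (f ≫ g) :=
    fun g hf hfg => hf (isIso_of_isIso_comp _ g).1
  have evalD : ∀ {j : I} (f : i ⟶ j) (hf : ¬ IsIso f) {Z : C} (d : Z ⟶ D) (b : Z ⟶ B.obj j),
      d ≫ dA ≫ A.map f = b ≫ p.app j → (d ≫ dQ f hf) ≫ (σ f hf).pt = b ≫ p.app j := by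
    intro j f hf Z d b h
    rw [Category.assoc, ← hD.w, h]
  -- The family of sections classified by an element of D is compatible, because the push of one
  -- universal section is a restriction of the next.
  have hnat : ∀ {j l : I} (f : i ⟶ j) (hf : ¬ IsIso f) (g : j ⟶ l) {Z : C} (d : Z ⟶ D)
      (b : Z ⟶ B.obj l) (h : d ≫ dA ≫ A.map (f ≫ g) = b ≫ p.app l),
      ((σ f hf).app g).app (d ≫ dQ f hf) b (by
          rw [Category.assoc, ← reassoc_of% hD.w f hf, ← h, A.map_comp]) =
        (σ (f ≫ g) (not_comp g hf)).eval.app (d ≫ dQ (f ≫ g) (not_comp g hf)) b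
          (evalD _ _ _ _ h) := by
    intro j l f hf g Z d b h
    refine (DiagSection.eval_push _ _ _ _ _).symm.trans ?_
    refine (DiagSection.eval_congr (hσn f g hf (not_comp g hf)).symm rfl rfl _).trans ?_
    rw [DiagSection.eval_restrict]
    refine DiagSection.eval_congr rfl ?_ rfl _
    rw [Category.assoc, hD.map]
  have hnat' : ∀ {j l : I} (f : i ⟶ j) (hf : ¬ IsIso f) (g : j ⟶ l) {Z : C} (d : Z ⟶ D)
      (b : Z ⟶ B.obj j) (h : d ≫ dA ≫ A.map f = b ≫ p.app j),
      (σ f hf).eval.app (d ≫ dQ f hf) b (evalD _ _ _ _ h) ≫ K.map g =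
        (σ (f ≫ g) (not_comp g hf)).eval.app (d ≫ dQ (f ≫ g) (not_comp g hf)) (b ≫ B.map g)
          (evalD _ _ _ _ (DiagSection.comp_map_eq f g h)) := fun f hf g Z d b h =>
    (DiagSection.eval_map _ _ _ _ _).trans (hnat f hf g d _ (DiagSection.comp_map_eq f g h))
  -- The generic family of elements of `K` on the boundary.
  obtain ⟨γ, hγB, hγK⟩ := hW.exists_lift (pullback.snd dA (p.app i))
    (fun f hf => (σ f hf).eval.app (pullback.fst dA (p.app i) ≫ dQ f hf)
      (pullback.snd _ _ ≫ B.map f) (evalD f hf _ _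
        (DiagSection.comp_map_eq_of_eq f pullback.condition)))
    (fun f g hf hfg => (hnat' f hf g _ _
        (DiagSection.comp_map_eq_of_eq f pullback.condition)).trans
      (DiagSection.eval_congr rfl rfl (by rw [Category.assoc, ← B.map_comp]) _))
    (fun f hf => ((σ f hf).eval.app_over _ _ _).symm)
  -- What is missing over D is a lift of `γ` through `R`, that is, a section of the pullback of `R`
  -- along `γ`. The pushforward to D classifies these.
  obtain ⟨⟨P, π, hP⟩, hall⟩ := hF (pullback.fst dA (p.app i)) (pullback.snd R γ)
    (F.pullback_fst _ _ hp) (F.pullback_snd _ _ hR)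
  obtain ⟨ev, hev⟩ := (isPushforward_iff _ _ _).1 hP
  have hfstB : pullback.fst R γ ≫ k.app i = pullback.snd _ _ ≫ pullback.snd _ _ := by
    rw [← hγB, ← pullback.condition_assoc, hRB]
  have hfstK : ∀ {j : I} (f : i ⟶ j) (hf : ¬ IsIso f), pullback.fst R γ ≫ K.map f =
      pullback.snd _ _ ≫ (σ f hf).eval.app (pullback.fst _ _ ≫ dQ f hf)
        (pullback.snd _ _ ≫ B.map f) (evalD f hf _ _
          (DiagSection.comp_map_eq_of_eq f pullback.condition)) := fun f hf => by
    rw [← hγK, ← pullback.condition_assoc, hRK]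
  -- The identity component of the section under construction: the universal element of P, projected
  -- to K_i.
  let c : FiberMap (p.app i) (k.app i) (π ≫ dA) :=
    { app := fun u b h => ev.app u (pullback.lift (u ≫ π) b ((Category.assoc _ _ _).trans h))
        (pullback.lift_fst _ _ _).symm ≫ pullback.fst _ _
      app_comp := fun g u b h => by
        refine (congrArg (· ≫ pullback.fst R γ) (ev.app_eq_comp
          (pullback.lift_fst _ _ ((Category.assoc _ _ _).trans h)).symm _ g rfl ?_)).trans
          (Category.assoc _ _ _)
        apply pullback.hom_ext <;> simp [pullback.lift_fst, pullback.lift_snd]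
      app_over := fun u b h => by
        rw [Category.assoc, hfstB, ← Category.assoc, ev.app_over, pullback.lift_snd] }
  -- Lying over `γ` means restricting to the prescribed boundary sections; this yields naturality of
  -- `τ` along composites that leave the identity.
  have hcK : ∀ {j : I} (f : i ⟶ j) (hf : ¬ IsIso f) {Z : C} (u : Z ⟶ P) (b : Z ⟶ B.obj i)
      (h : u ≫ π ≫ dA = b ≫ p.app i), c.app u b h ≫ K.map f =
        (σ f hf).eval.app ((u ≫ π) ≫ dQ f hf) (b ≫ B.map f)
          (evalD f hf _ _ (DiagSection.comp_map_eq_of_eq f (by rw [Category.assoc, h]))) := by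
    intro j f hf Z u b h
    dsimp only [c]
    rw [Category.assoc, hfstK f hf, ← Category.assoc, ev.app_over, ← FiberMap.app_comp]
    refine DiagSection.eval_congr rfl ?_ ?_ _
    · rw [pullback.lift_fst_assoc]
    · rw [pullback.lift_snd_assoc]
  have hcev : ∀ {Z : C} (u : Z ⟶ P) (b : Z ⟶ pullback dA (p.app i))
      (h : u ≫ π = b ≫ pullback.fst _ _), ev.app u b h ≫ pullback.fst _ _ =
        c.app u (b ≫ pullback.snd _ _)
          (by rw [← Category.assoc, h, Category.assoc, pullback.condition, Category.assoc]) := by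
    intro Z u b h
    dsimp only [c]
    congr 1
    refine ev.app_congr rfl ?_ _
    apply pullback.hom_ext <;> simp [pullback.lift_fst, pullback.lift_snd, h]
  -- Components at invertible f are transported from `c`, the others are read off from `σ`. An
  -- existence statement with both descriptions keeps the case split out of the data.
  have hφ : ∀ (j : I) (f : i ⟶ j), ∃ φ : FiberMap (p.app j) (k.app j) ((π ≫ dA) ≫ A.map f),
      (IsIso f → ∀ {Z : C} (u : Z ⟶ P) (b : Z ⟶ B.obj i) (h : u ≫ π ≫ dA = b ≫ p.app i),
        φ.app u (b ≫ B.map f) (DiagSection.comp_map_eq_of_eq f h) = c.app u b h ≫ K.map f) ∧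
      (∀ (hf : ¬ IsIso f) {Z : C} (u : Z ⟶ P) (b : Z ⟶ B.obj j)
        (h : u ≫ (π ≫ dA) ≫ A.map f = b ≫ p.app j),
        φ.app u b h = (σ f hf).eval.app ((u ≫ π) ≫ dQ f hf) b
          (evalD f hf _ _ (by simpa using h))) := by
    intro j f
    by_cases hf : IsIso f
    · have aux : ∀ {Z : C} (u : Z ⟶ P) (b : Z ⟶ B.obj j)
          (h : u ≫ (π ≫ dA) ≫ A.map f = b ≫ p.app j),
          u ≫ π ≫ dA = (b ≫ B.map (inv f)) ≫ p.app i := fun u b h => by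
        simpa using DiagSection.comp_map_eq f (inv f) h
      refine ⟨{ app := fun u b h => c.app u (b ≫ B.map (inv f)) (aux u b h) ≫ K.map f
                app_comp := fun g u b h => ?_
                app_over := fun u b h => ?_ }, fun _ Z u b h => ?_, fun h => (h hf).elim⟩
      · exact (congrArg (· ≫ K.map f) (c.app_eq_comp (aux u b h) _ g rfl
          (Category.assoc _ _ _).symm)).trans (Category.assoc _ _ _)
      · rw [Category.assoc, k.naturality, ← Category.assoc, c.app_over]
        simp
      · dsimp only
        congr 1
        exact c.app_congr rfl (by simp) _
    · refine ⟨{ app := fun u b h => (σ f hf).eval.app ((u ≫ π) ≫ dQ f hf) b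
                  (evalD f hf _ _ (by simpa using h))
                app_comp := fun g u b h => ?_
                app_over := fun u b h => FiberMap.app_over _ _ _ _ },
              fun h => (hf h).elim, fun _ Z u b h => rfl⟩
      exact FiberMap.app_eq_comp _ _ _ g (by simp) rfl
  choose φ φ_iso φ_not using hφ
  let τ : DiagSection p k i P :=
    { pt := π ≫ dA
      app := fun {j} f => φ j f
      naturality := by
        intro j l f g Z u b h
        by_cases hf : IsIso f
        · obtain ⟨b, rfl⟩ : ∃ b' : Z ⟶ B.obj i, b' ≫ B.map f = b := ⟨b ≫ B.map (inv f), by simp⟩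
          have h' : u ≫ π ≫ dA = b ≫ p.app i := by
            simpa using DiagSection.comp_map_eq f (inv f) h
          rw [φ_iso j f hf u b h']
          refine Eq.trans ?_ ((φ l (f ≫ g)).app_congr rfl
            (by rw [Category.assoc, ← B.map_comp]) (DiagSection.comp_map_eq_of_eq (f ≫ g) h'))
          by_cases hfg : IsIso (f ≫ g)
          · rw [φ_iso l (f ≫ g) hfg u b h', K.map_comp, Category.assoc]
          · rw [φ_not l (f ≫ g) hfg, Category.assoc, ← K.map_comp]
            exact hcK (f ≫ g) hfg u b h'
        · rw [φ_not j f hf, φ_not l (f ≫ g) (not_comp g hf)]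
          exact hnat' f hf g (u ≫ π) b (by simpa using h) }
  have τ_eval : ∀ {Z : C} (u : Z ⟶ P) (b : Z ⟶ B.obj i) (h : u ≫ π ≫ dA = b ≫ p.app i),
      τ.eval.app u b h = c.app u b h := by
    intro Z u b h
    have := φ_iso i (𝟙 i) inferInstance u b h
    rw [K.map_id, Category.comp_id] at this
    rw [← this]
    exact (φ i (𝟙 i)).app_congr rfl (by simp) _
  have τ_push : ∀ {j : I} (f : i ⟶ j) (hf : ¬ IsIso f),
      (σ f hf).restrict (π ≫ dQ f hf) = τ.push f := by
    intro j f hf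
    refine DiagSection.ext_app ?_ fun g Z u b h => ?_
    · change (π ≫ dQ f hf) ≫ _ = (π ≫ dA) ≫ _
      rw [Category.assoc, Category.assoc, hD.w f hf]
    · have h' : (u ≫ π) ≫ dA ≫ A.map (f ≫ g) = b ≫ p.app _ := by
        rw [← h, A.map_comp, reassoc_of% hD.w f hf]
        simp [DiagSection.restrict]
      refine Eq.trans ?_ (φ_not _ (f ≫ g) (not_comp g hf) u b (by simpa using h')).symm
      refine Eq.trans ?_ (hnat f hf g (u ≫ π) b h')
      exact DiagSection.app_congr rfl rfl (Category.assoc _ _ _).symm rfl _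
  refine ⟨P, π, τ, hall _ _ hP, ?_, rfl, τ_push⟩
  intro X ρ
  -- The boundary of `ρ` is classified by a map `d` to `D`.
  choose t ht _ using fun (j : I) (f : i ⟶ j) (hf : ¬ IsIso f) => hσ f hf (ρ.push f)
  obtain ⟨d, hdA, hdQ⟩ := hD.exists_lift ρ.pt (fun f hf => t _ f hf)
    (fun f g hf hfg => (hσ _ hfg).hom_ext (by
      rw [← DiagSection.restrict_restrict, hσn, DiagSection.push_restrict, ht, ht,
        DiagSection.push_push]))
    (fun f hf => (congrArg DiagSection.pt (ht _ f hf)).symm)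
  have hρ : ∀ {Z : C} (u : Z ⟶ X) (b : Z ⟶ pullback dA (p.app i))
      (h : u ≫ d = b ≫ pullback.fst _ _), u ≫ ρ.pt = (b ≫ pullback.snd _ _) ≫ p.app i := by
    intro Z u b h
    rw [← hdA, ← Category.assoc, h, Category.assoc, pullback.condition, Category.assoc]
  -- The identity component of `ρ` lies over `γ` because its boundary is the one classified by `d`;
  -- so it factors through the pullback of `R` along `γ`.
  have hρW : ∀ {Z : C} (u : Z ⟶ X) (b : Z ⟶ pullback dA (p.app i))
      (h : u ≫ d = b ≫ pullback.fst _ _), ρ.eval.app u _ (hρ u b h) ≫ R = b ≫ γ := by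
    intro Z u b h
    refine hW.hom_ext ?_ fun f hf => ?_
    · rw [Category.assoc, hRB, FiberMap.app_over, Category.assoc, hγB]
    · rw [Category.assoc, hRK, Category.assoc, hγK, DiagSection.eval_map, ← FiberMap.app_comp]
      refine (DiagSection.eval_push ρ f u _ _).symm.trans ?_
      refine (DiagSection.eval_congr (ht _ f hf).symm rfl rfl _).trans ?_
      rw [DiagSection.eval_restrict]
      refine DiagSection.eval_congr rfl ?_ (Category.assoc _ _ _) _
      rw [← hdQ, ← Category.assoc, h, Category.assoc]
  let ψ : FiberMap (pullback.fst dA (p.app i)) (pullback.snd R γ) d :=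
    { app := fun u b h => pullback.lift (ρ.eval.app u _ (hρ u b h)) b (hρW u b h)
      app_comp := fun g u b h => by
        apply pullback.hom_ext
        · refine (pullback.lift_fst _ _ _).trans (Eq.trans ?_ ((Category.assoc _ _ _).trans
            (congrArg (g ≫ ·) (pullback.lift_fst _ _ _))).symm)
          exact FiberMap.app_eq_comp _ _ _ g rfl (Category.assoc _ _ _).symm
        · exact (pullback.lift_snd _ _ _).trans ((Category.assoc _ _ _).trans
            (congrArg (g ≫ ·) (pullback.lift_snd _ _ _))).symm
      app_over := fun u b h => pullback.lift_snd _ _ _ }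
  -- Sections restricting to `ρ` are the same as lifts of `ψ`.
  have key : ∀ s : X ⟶ P, τ.restrict s = ρ ↔ ∃ hs : s ≫ π = d,
      ∀ ⦃Z : C⦄ (u : Z ⟶ X) (b : Z ⟶ pullback dA (p.app i)) (h : u ≫ d = b ≫ pullback.fst _ _),
        ev.app (u ≫ s) b (by rw [Category.assoc, hs, h]) = ψ.app u b h := by
    intro s
    constructor
    · intro H
      have hs : s ≫ π = d := by
        refine hD.hom_ext ?_ fun f hf => (hσ f hf).hom_ext ?_
        · rw [hdA, ← H, Category.assoc]
          rfl
        · rw [hdQ, ht, ← H, ← DiagSection.push_restrict, ← τ_push f hf,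
            DiagSection.restrict_restrict, Category.assoc]
      refine ⟨hs, fun Z u b h => pullback.hom_ext ?_ ?_⟩
      · rw [hcev, ← τ_eval, pullback.lift_fst]
        refine (DiagSection.eval_restrict τ s u _ ?_).symm.trans (DiagSection.eval_congr H rfl rfl _)
        rw [H]
        exact hρ u b h
      · rw [ev.app_over, pullback.lift_snd]
    · rintro ⟨hs, H⟩
      have h1 : s ≫ π ≫ dA = ρ.pt := by rw [← hdA, ← hs, Category.assoc]
      have h2 : ∀ {Z : C} (u : Z ⟶ X) (b : Z ⟶ B.obj i) (h : u ≫ ρ.pt = b ≫ p.app i),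
          c.app (u ≫ s) b (by rw [Category.assoc, h1, h]) = ρ.eval.app u b h := by
        intro Z u b h
        -- The hypothesis is tested at the element (u ≫ d, b) of D ×_{A_i} B_i and projected to K_i.
        have h3 := congrArg (· ≫ pullback.fst _ _) (H u (pullback.lift (u ≫ d) b
          (by rw [Category.assoc, hdA, h])) (pullback.lift_fst _ _ _).symm)
        dsimp only [ψ] at h3
        replace h3 := (hcev _ _ _).symm.trans (h3.trans (pullback.lift_fst _ _ _))
        exact (c.app_congr rfl (pullback.lift_snd _ _ _).symm _).trans
          (h3.trans (FiberMap.app_congr _ rfl (pullback.lift_snd _ _ _) _))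
      refine DiagSection.ext_app h1 fun {j} f Z u b h => ?_
      have h' : u ≫ ρ.pt ≫ A.map f = b ≫ p.app j := by rw [← h1]; exact h
      by_cases hf : IsIso f
      · obtain ⟨b, rfl⟩ : ∃ b' : Z ⟶ B.obj i, b' ≫ B.map f = b := ⟨b ≫ B.map (inv f), by simp⟩
        have h4 : u ≫ ρ.pt = b ≫ p.app i := by
          simpa using DiagSection.comp_map_eq f (inv f) h'
        refine (φ_iso j f hf (u ≫ s) b (by rw [Category.assoc, h1, h4])).trans ?_
        rw [h2 u b h4, DiagSection.eval_map]
      · refine (φ_not j f hf (u ≫ s) b (by rw [← h]; simp [τ, DiagSection.restrict])).trans ?_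
        refine Eq.trans ?_ (DiagSection.eval_push ρ f u b h')
        refine Eq.trans ?_ (DiagSection.eval_congr (ht _ f hf) rfl rfl (by rw [ht]; exact h'))
        rw [DiagSection.eval_restrict]
        refine DiagSection.eval_congr rfl ?_ rfl _
        rw [← hdQ, ← hs]
        simp
  simpa only [key] using hev d ψ

end

/-! ### Pushforwards of diagrams -/

section

variable {I : Type w} [SmallCategory I] [FinCategory I] [IsInverseCategory I]
  {C : Type u} [Category.{v} C] [HasFiniteLimits C] {A B K : I ⥤ C} {p : B ⟶ A} {k : K ⟶ B}

/-- The extension theorem with both classifying objects given by actual limits over the boundary, so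
that its fibration can be compared with a relative matching map. -/
theorem exists_universal_of_boundary (F : MorphismProperty C) [F.IsMultiplicative]
    [F.IsStableUnderBaseChange] (hF : StableUnderPushforward F) {i : I} (hp : F (p.app i))
    (hk : F (relativeMatchingMap k i)) (Q : Boundary i ⥤ C)
    (σ : ∀ g : Boundary i, DiagSection p k ((Boundary.proj i).obj g) (Q.obj g))
    (hσ : ∀ g, (σ g).IsUniversal)
    (hσn : ∀ {g g' : Boundary i} (a : g ⟶ g'),
      (σ g').restrict (Q.map a) = (σ g).push ((Boundary.proj i).map a))
    (q : limit Q ⟶ matchingObj A i)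
    (hq : ∀ g, q ≫ matchingObjProj A i g = limit.π Q g ≫ (σ g).pt) :
    ∃ (P : C) (π : P ⟶ pullback (matchingMap A i) q) (τ : DiagSection p k i P), F π ∧
      τ.IsUniversal ∧ τ.pt = π ≫ pullback.fst _ _ ∧
      ∀ g, (σ g).restrict (π ≫ pullback.snd _ _ ≫ limit.π Q g) = τ.push g.obj.hom := by
  obtain ⟨P, π, τ, h1, h2, h3, h4⟩ := exists_universal_of_isRelativeMatching F hF hp hk
    (isRelativeMatching_pullback (Boundary.proj i ⋙ K) (matchingObjMap k i)
      (fun g => k.app g.obj.right) (matchingObjMap_proj k i))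
    (relativeMatchingMap_fst k i)
    (fun f hf => (relativeMatchingMap_snd_assoc k i _).trans
      (matchingMap_proj K i (Boundary.mk f hf)))
    (σ := fun f hf => σ (Boundary.mk f hf)) (fun f hf => hσ _)
    (fun f g hf hfg => hσn (Boundary.homMk f g hf hfg))
    (isRelativeMatching_pullback Q q (fun g => (σ g).pt) hq)
  exact ⟨P, π, τ, h1, h2, h3, fun g => h4 g.obj.hom g.not_isIso⟩

/-- Strong induction on degree: objects of the boundary have smaller degree, and their universal
sections assemble into a functor on the boundary. -/
theorem exists_universal (F : MorphismProperty C) [F.IsMultiplicative]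
    [F.IsStableUnderBaseChange] (hF : StableUnderPushforward F) (hp : reedyFibrations F p)
    (hk : reedyFibrations F k) (i : I) :
    ∃ (Q : C) (σ : DiagSection p k i Q), σ.IsUniversal := by
  obtain ⟨deg, hdeg⟩ := IsInverseCategory.exists_degree (I := I)
  induction hn : deg i using Nat.strong_induction_on generalizing i with
  | _ n ih =>
    subst hn
    have ih' : ∀ g : Boundary i, ∃ (Q : C) (σ : DiagSection p k ((Boundary.proj i).obj g) Q),
        σ.IsUniversal := fun g => by
      refine ih _ (hdeg g.obj.hom ?_) _ rfl
      rintro ⟨e, h⟩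
      apply g.not_isIso
      rw [h]
      infer_instance
    choose Q₀ σ₀ hσ₀ using ih'
    obtain ⟨Q, σ, hσ, hσn⟩ :=
      DiagSection.exists_functor_of_isUniversal (Boundary.proj i) Q₀ σ₀ hσ₀
    let α : Q ⟶ Boundary.proj i ⋙ A :=
      { app := fun g => (σ g).pt
        naturality := fun g g' a => congrArg DiagSection.pt (hσn a) }
    obtain ⟨P, π, τ, -, hτ, -⟩ := exists_universal_of_boundary F hF
      (app_mem_of_reedyFibrations F hp i) (hk i) Q σ hσ hσn (limMap α) (fun g => limMap_π α g)
    exact ⟨P, τ, hτ⟩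

omit [FinCategory I] [IsInverseCategory I] [HasFiniteLimits C] in
theorem DiagSection.IsUniversal.isIso {i : I} {X Y : C} {σ : DiagSection p k i X}
    {τ : DiagSection p k i Y} (hσ : σ.IsUniversal) (hτ : τ.IsUniversal) (e : Y ⟶ X)
    (he : σ.restrict e = τ) : IsIso e := by
  obtain ⟨e', he', -⟩ := hτ σ
  refine ⟨e', hτ.hom_ext ?_, hσ.hom_ext ?_⟩
  · rw [← restrict_restrict, he', he, restrict_id]
  · rw [← restrict_restrict, he, he', restrict_id]

/-- Extending the given universal sections from the boundary produces a second universal section at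
i, over a fibration. Uniqueness identifies its object with Q_i and that fibration with the relative
matching map. -/
theorem reedyFibrations_of_isUniversal (F : MorphismProperty C) [F.IsMultiplicative]
    [F.IsStableUnderBaseChange] (hF : StableUnderPushforward F) (hp : reedyFibrations F p)
    (hk : reedyFibrations F k) {Q : I ⥤ C} (q : Q ⟶ A)
    (σ : ∀ i : I, DiagSection p k i (Q.obj i)) (hσ : ∀ i, (σ i).IsUniversal)
    (hσn : ∀ {i j : I} (f : i ⟶ j), (σ j).restrict (Q.map f) = (σ i).push f)
    (hq : ∀ i, (σ i).pt = q.app i) : reedyFibrations F q := by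
  intro i
  obtain ⟨P, π, τ, hπ, hτ, hpt, hres⟩ :
      ∃ (P : C) (π : P ⟶ pullback (matchingMap A i) (matchingObjMap q i))
        (τ : DiagSection p k i P), F π ∧ τ.IsUniversal ∧ τ.pt = π ≫ pullback.fst _ _ ∧
        ∀ g : Boundary i, (σ g.obj.right).restrict
          (π ≫ pullback.snd _ _ ≫ matchingObjProj Q i g) = τ.push g.obj.hom :=
    exists_universal_of_boundary F hF
      (app_mem_of_reedyFibrations F hp i) (hk i) (Boundary.proj i ⋙ Q) (fun g => σ g.obj.right)
      (fun g => hσ _) (fun a => hσn _) (matchingObjMap q i)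
      (fun g => (matchingObjMap_proj q i g).trans (by rw [hq]; rfl))
  obtain ⟨e, he, -⟩ := hσ i τ
  have := (hσ i).isIso hτ e he
  have h : e ≫ relativeMatchingMap q i = π := by
    refine pullback.hom_ext ?_ (matchingObj_hom_ext fun g => (hσ g.obj.right).hom_ext ?_)
    · rw [Category.assoc, relativeMatchingMap_fst, ← hpt, ← he, ← hq]
      rfl
    · rw [Category.assoc π, hres, Category.assoc, Category.assoc, relativeMatchingMap_snd_assoc,
        matchingMap_proj]
      refine (DiagSection.restrict_restrict _ (Q.map g.obj.hom) e).symm.trans ?_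
      rw [← he, ← DiagSection.push_restrict, ← hσn g.obj.hom]
  rw [← h] at hπ
  exact (F.cancel_left_of_respectsIso e _).1 hπ

omit [FinCategory I] [IsInverseCategory I] in
/-- A functor of universal sections is a pushforward in the category of diagrams. -/
theorem isPushforward_of_isUniversal {Q : I ⥤ C} (q : Q ⟶ A)
    (σ : ∀ i : I, DiagSection p k i (Q.obj i)) (hσ : ∀ i, (σ i).IsUniversal)
    (hσn : ∀ {i j : I} (f : i ⟶ j), (σ j).restrict (Q.map f) = (σ i).push f)
    (hq : ∀ i, (σ i).pt = q.app i) : IsPushforward p k q := by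
  rw [isPushforward_iff]
  have w : ∀ {X : I ⥤ C} {a : X ⟶ A} {Z : I ⥤ C} {u : Z ⟶ X} {b : Z ⟶ B}, u ≫ a = b ≫ p →
      ∀ i, u.app i ≫ a.app i = b.app i ≫ p.app i := fun h i => congrArg (fun f => f.app i) h
  let ev : FiberMap p k q :=
    { app := fun {Z} u b h =>
        { app := fun i => (σ i).eval.app (u.app i) (b.app i) (by rw [hq, w h])
          naturality := fun i j f => by
            have h' : u.app i ≫ ((σ j).restrict (Q.map f)).pt =
                (Z.map f ≫ b.app j) ≫ p.app j := by
              rw [hσn, b.naturality, Category.assoc, p.naturality, ← reassoc_of% (w h i), ← hq]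
              rfl
            rw [DiagSection.eval_map]
            refine Eq.trans ?_ (DiagSection.eval_push (σ i) f _ _ _)
            refine Eq.trans ?_ (DiagSection.eval_congr (hσn f) rfl (b.naturality f) h')
            exact (FiberMap.app_eq_comp (σ j).eval _ ((Category.assoc _ _ _).trans h') _
              (u.naturality f) rfl).symm }
      app_comp := fun g u b h => by
        ext i
        exact FiberMap.app_comp _ _ _ _ _
      app_over := fun u b h => by
        ext i
        exact FiberMap.app_over _ _ _ _ }
  refine ⟨ev, fun X a φ => ?_⟩
  have H := IsPullback.of_hasPullback a p
  have Hi : ∀ i, IsPullback ((pullback.fst a p).app i) ((pullback.snd a p).app i) (a.app i)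
      (p.app i) := fun i => H.map ((evaluation I C).obj i)
  let m := φ.app (pullback.fst a p) (pullback.snd a p) H.w
  have hm : m ≫ k = pullback.snd a p := φ.app_over _ _ _
  -- Pullbacks of diagrams are computed levelwise, so `φ` acts on elements at each single stage, not
  -- just on elements defined on whole diagrams.
  let ψ : ∀ i, FiberMap (p.app i) (k.app i) (a.app i) := fun i =>
    .ofIsPullback (Hi i) (m.app i) (congrArg (fun f => f.app i) hm)
  have hψ : ∀ {i : I} {Z : C} {u : Z ⟶ X.obj i} {b : Z ⟶ B.obj i}
      (h : u ≫ a.app i = b ≫ p.app i) (l : Z ⟶ (pullback a p).obj i)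
      (_ : l ≫ (pullback.fst a p).app i = u) (_ : l ≫ (pullback.snd a p).app i = b),
      (ψ i).app u b h = l ≫ m.app i := fun h l h1 h2 => FiberMap.ofIsPullback_app _ _ _ h l h1 h2
  have hψφ : ∀ {Z : I ⥤ C} (u : Z ⟶ X) (b : Z ⟶ B) (h : u ≫ a = b ≫ p) (i : I),
      (ψ i).app (u.app i) (b.app i) (w h i) = (φ.app u b h).app i := by
    intro Z u b h i
    rw [hψ _ ((H.lift u b h).app i) (congrArg (fun f => f.app i) (H.lift_fst u b h))
      (congrArg (fun f => f.app i) (H.lift_snd u b h)), 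
      φ.app_eq_comp H.w h (H.lift u b h) (H.lift_fst u b h) (H.lift_snd u b h)]
    rfl
  have hψn : ∀ {i j : I} (f : i ⟶ j) {Z : C} {u : Z ⟶ X.obj i} {b : Z ⟶ B.obj i}
      (h : u ≫ a.app i = b ≫ p.app i), (ψ i).app u b h ≫ K.map f =
        (ψ j).app (u ≫ X.map f) (b ≫ B.map f) (by
          rw [Category.assoc, a.naturality, reassoc_of% h, Category.assoc, p.naturality]) := by
    intro i j f Z u b h
    rw [hψ h ((Hi i).lift u b h) (by simp) (by simp), Category.assoc, ← m.naturality,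
      ← Category.assoc]
    refine (hψ _ _ ?_ ?_).symm
    · rw [Category.assoc, NatTrans.naturality, (Hi i).lift_fst_assoc]
    · rw [Category.assoc, NatTrans.naturality, (Hi i).lift_snd_assoc]
  have aux : ∀ {i j : I} (f : i ⟶ j) {Z : C} {u : Z ⟶ X.obj i} {b : Z ⟶ B.obj j},
      u ≫ a.app i ≫ A.map f = b ≫ p.app j → (u ≫ X.map f) ≫ a.app j = b ≫ p.app j :=
    fun f _ _ _ h => by rw [Category.assoc, a.naturality, h]
  -- The section over X_i attached to `φ`: its component at f moves the element along X_f and then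
  -- applies `φ` at stage j.
  let ρ : ∀ i, DiagSection p k i (X.obj i) := fun i =>
    { pt := a.app i
      app := fun {j} f =>
        { app := fun u b h => (ψ j).app (u ≫ X.map f) b (aux f h)
          app_comp := fun g u b h => FiberMap.app_eq_comp _ _ _ g (Category.assoc _ _ _).symm rfl
          app_over := fun u b h => FiberMap.app_over _ _ _ _ }
      naturality := fun f g Z u b h => (hψn g _).trans
        (FiberMap.app_congr _ (by rw [Category.assoc, ← X.map_comp]) rfl _) }
  have hρ : ∀ {i j : I} (f : i ⟶ j), (ρ j).restrict (X.map f) = (ρ i).push f := fun f =>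
    DiagSection.ext_app (a.naturality f) fun {l} g Z u b h => by
      refine FiberMap.app_congr (ψ l) ?_ rfl _
      rw [Category.assoc, ← X.map_comp]
  choose s hs hs' using fun i => hσ i (ρ i)
  have key : ∀ t : X ⟶ Q, (∀ i, (σ i).restrict (t.app i) = ρ i) ↔ ∃ ht : t ≫ q = a,
      ∀ ⦃Z : I ⥤ C⦄ (u : Z ⟶ X) (b : Z ⟶ B) (h : u ≫ a = b ≫ p),
        ev.app (u ≫ t) b (by rw [Category.assoc, ht, h]) = φ.app u b h := by
    intro t
    constructor
    · intro ht
      have htq : t ≫ q = a := by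
        ext i
        rw [NatTrans.comp_app, ← hq]
        exact congrArg DiagSection.pt (ht i)
      refine ⟨htq, fun Z u b h => ?_⟩
      ext i
      rw [← hψφ]
      refine Eq.trans (DiagSection.eval_congr (ht i) rfl rfl ?_) ?_
      · rw [ht]
        exact w h i
      · refine FiberMap.app_congr (ψ i) ?_ rfl _
        rw [X.map_id, Category.comp_id]
    · rintro ⟨htq, ht⟩ i
      -- An element at one stage need not come from a map of diagrams, but it factors through stage
      -- j of the generic one, the pullback of `a` and `p`.
      have gen : ∀ {j : I} {Z : C} (v : Z ⟶ X.obj j) (b : Z ⟶ B.obj j)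
          (h : v ≫ a.app j = b ≫ p.app j), (σ j).eval.app (v ≫ t.app j) b (by
            rw [hq, Category.assoc, ← NatTrans.comp_app, htq, h]) = (ψ j).app v b h := by
        intro j Z v b h
        have h1 := congrArg (fun f => f.app j) (ht _ _ H.w)
        rw [hψ h ((Hi j).lift v b h) (by simp) (by simp)]
        refine Eq.trans ?_ (congrArg ((Hi j).lift v b h ≫ ·) h1)
        refine FiberMap.app_eq_comp (σ j).eval ?_ _ _ ?_ (by simp)
        · rw [hq, ← NatTrans.comp_app, Category.assoc, htq]
          exact w H.w j
        rw [NatTrans.comp_app, (Hi j).lift_fst_assoc]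
      have hpt : ((σ i).restrict (t.app i)).pt = a.app i := by
        change t.app i ≫ (σ i).pt = a.app i
        rw [hq, ← NatTrans.comp_app, htq]
      refine DiagSection.ext_app hpt fun {j} f Z u b h => ?_
      have h0 : u ≫ a.app i ≫ A.map f = b ≫ p.app j := by
        rw [← h, hpt]
      refine Eq.trans ?_ (gen (u ≫ X.map f) b (aux f h0))
      refine (DiagSection.eval_push (σ i) f (u ≫ t.app i) b
        (by simpa [DiagSection.push, DiagSection.restrict] using h)).symm.trans ?_
      refine (DiagSection.eval_congr (hσn f).symm rfl rfl _).trans ?_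
      rw [DiagSection.eval_restrict]
      exact DiagSection.eval_congr rfl (by simp) rfl _
  let S : X ⟶ Q :=
    { app := s
      naturality := fun i j f => (hσ j).hom_ext (by
        rw [← DiagSection.restrict_restrict, hs, ← DiagSection.restrict_restrict, hσn,
          DiagSection.push_restrict, hs, hρ]) }
  refine ⟨S, (key S).1 hs, fun t ht => ?_⟩
  ext i
  exact hs' i _ ((key t).2 ht i)

end

end InverseDiagrams

/-! ### The main theorem -/

theorem mainTheorem2 {C : Type u} [Category.{v} C] [HasFiniteLimits C]
    {I : Type w} [SmallCategory I] [FinCategory I] [InverseDiagrams.IsInverseCategory I]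
    (F : MorphismProperty C) [F.IsMultiplicative] [F.IsStableUnderBaseChange]
    (hF : InverseDiagrams.StableUnderPushforward F) :
    InverseDiagrams.StableUnderPushforward
      (InverseDiagrams.reedyFibrations F : MorphismProperty (I ⥤ C)) := by
  intro A B K p k hp hk
  choose Q₀ σ₀ hσ₀ using InverseDiagrams.exists_universal F hF hp hk
  obtain ⟨Q, σ, hσ, hσn⟩ :=
    InverseDiagrams.DiagSection.exists_functor_of_isUniversal (𝟭 I) Q₀ σ₀ hσ₀
  let q : Q ⟶ A :=
    { app := fun i => (σ i).pt
      naturality := fun i j f => congrArg InverseDiagrams.DiagSection.pt (hσn f) }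
  have hQ : InverseDiagrams.IsPushforward p k q :=
    InverseDiagrams.isPushforward_of_isUniversal q σ hσ hσn fun _ => rfl
  refine ⟨⟨Q, q, hQ⟩, fun P r hr => ?_⟩
  -- Any pushforward is isomorphic over A to the constructed one; restricting the universal sections
  -- along this isomorphism makes the Reedy criterion apply to `r` itself.
  let e : Over.mk r ≅ Over.mk q := hr.some.uniqueUpToIso hQ.some
  have he : e.hom.left ≫ q = r := Over.w e.hom
  have : IsIso e.hom.left := inferInstanceAs (IsIso ((Over.forget A).map e.hom))
  refine InverseDiagrams.reedyFibrations_of_isUniversal F hF hp hk r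
    (fun i => (σ i).restrict (e.hom.left.app i)) (fun i => (hσ i).restrict_iso _)
    (fun {i j} f => ?_) (fun i => congrArg (fun f => f.app i) he)
  rw [InverseDiagrams.DiagSection.restrict_restrict, NatTrans.naturality,
    ← InverseDiagrams.DiagSection.restrict_restrict]
  refine (congrArg (fun τ => InverseDiagrams.DiagSection.restrict τ (e.hom.left.app i))
    (hσn f)).trans ?_
  exact InverseDiagrams.DiagSection.push_restrict _ _ _
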